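/- Let $k$ be a field. For $n\ge 2$ and a primitive $n$-th root of unity $q\in k$, the Taft algebra $H_n(q)$ is the Hopf algebra over $k$ generated by $g,h$ subject to $g^n=1$, $h^n=0$, $hg=qgh$, with $\Delta(g)=g\otimes g$, $\Delta(h)=1\otimes h+h\otimes g$, $\varepsilon(g)=1$, $\varepsilon(h)=0$, $S(g)=g^{n-1}$, $S(h)=-q^{-1}g^{n-1}h$. The Green ring $r(H)$ of a Hopf algebra $H$ over $k$ is the abelian group generated by the isomorphism classes $[V]$ of finite dimensional left $H$-modules modulo the relations $[M\oplus V]=[M]+[V]$, with multiplication $[M][V]=[M\otimes V]$, where $\otimes=\otimes_k$ and $H$ acts on $M\otimes V$ through $\Delta$. For each $n\in\{2,\dots,8\}$ and each primitive $n$-th root of unity $q\in k$ there is a ring isomorphism $$r(H_n(q))\;\cong\;\mathbb Z[y,z]/\bigl(y^n-1,\ (z-y-1)f_n\bigr),$$ where $$\begin{aligned} f_2&=z, & f_3&=z^2-y, & f_4&=z^3-2yz,\\ f_5&=z^4-3yz^2+y^2, & f_6&=z^5-4yz^3+3y^2z, & f_7&=z^6-5yz^4+6y^2z^2-y^3,\\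 f_8&=z^7-6yz^5+10y^2z^3-4y^3z. &&&& \end{aligned}$$ -/

import Mathlib

open scoped TensorProduct

universe u v

/-! ## The action of `H ⊗ H` on a tensor product -/

section OuterAction

variable {k : Type*} [Field k] {H : Type*} [Ring H]
  {V W U V' W' : Type*} [AddCommGroup V] [Module k V] [AddCommGroup W] [Module k W]
  [AddCommGroup U] [Module k U] [AddCommGroup V'] [Module k V'] [AddCommGroup W'] [Module k W']

section Algebra

variable {A B : Type*} [Ring A] [Algebra k A] [Ring B] [Algebra k B]

/-- If `A` acts on `V` and `B` acts on `W`, then `A ⊗ B` acts on `V ⊗ W` by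
`(a ⊗ b) • (v ⊗ w) = (a • v) ⊗ (b • w)`. -/
noncomputable def outerAction (ρ : A →ₐ[k] Module.End k V) (σ : B →ₐ[k] Module.End k W) :
    A ⊗[k] B →ₐ[k] Module.End k (V ⊗[k] W) :=
  (Module.endTensorEndAlgHom (R := k) (S := k) (A := k)).comp (Algebra.TensorProduct.map ρ σ)

theorem outerAction_tmul (ρ : A →ₐ[k] Module.End k V) (σ : B →ₐ[k] Module.End k W)
    (a : A) (b : B) (v : V) (w : W) :
    outerAction ρ σ (a ⊗ₜ b) (v ⊗ₜ w) = ρ a v ⊗ₜ σ b w := rfl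

theorem outerAction_congr {ρ : A →ₐ[k] Module.End k V} {σ : B →ₐ[k] Module.End k W}
    {ρ' : A →ₐ[k] Module.End k V'} {σ' : B →ₐ[k] Module.End k W'} {e : V ≃ₗ[k] V'}
    {f : W ≃ₗ[k] W'} (he : ∀ a v, e (ρ a v) = ρ' a (e v)) (hf : ∀ b w, f (σ b w) = σ' b (f w))
    (t : A ⊗[k] B) (v : V ⊗[k] W) :
    TensorProduct.congr e f (outerAction ρ σ t v) =
      outerAction ρ' σ' t (TensorProduct.congr e f v) := by
  induction t with
  | zero => simp
  | add x y hx hy => simp only [map_add, LinearMap.add_apply, hx, hy]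
  | tmul x y =>
    induction v with
    | zero => simp
    | add v w hv hw => simp only [map_add, hv, hw]
    | tmul m n => simp only [outerAction_tmul, TensorProduct.congr_tmul, he, hf]

theorem outerAction_prodRight (ρ : A →ₐ[k] Module.End k V) (σ : B →ₐ[k] Module.End k W)
    (τ : B →ₐ[k] Module.End k U) (t : A ⊗[k] B) (v : V ⊗[k] (W × U)) :
    TensorProduct.prodRight k k V W U
        (outerAction ρ ((LinearMap.prodMapAlgHom k W U).comp (σ.prod τ)) t v) =
      (outerAction ρ σ t (TensorProduct.prodRight k k V W U v).1,
        outerAction ρ τ t (TensorProduct.prodRight k k V W U v).2) := by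
  induction t with
  | zero => simp; rfl
  | add x y hx hy => simp only [map_add, LinearMap.add_apply, hx, hy, Prod.mk_add_mk]
  | tmul x y =>
    induction v with
    | zero => simp; rfl
    | add v w hv hw => simp only [map_add, hv, hw, Prod.fst_add, Prod.snd_add, Prod.mk_add_mk]
    | tmul m n => rfl

theorem outerAction_prodLeft (ρ : A →ₐ[k] Module.End k V) (σ : A →ₐ[k] Module.End k W)
    (τ : B →ₐ[k] Module.End k U) (t : A ⊗[k] B) (v : (V × W) ⊗[k] U) :
    TensorProduct.prodLeft k k V W U
        (outerAction ((LinearMap.prodMapAlgHom k V W).comp (ρ.prod σ)) τ t v) =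
      (outerAction ρ τ t (TensorProduct.prodLeft k k V W U v).1,
        outerAction σ τ t (TensorProduct.prodLeft k k V W U v).2) := by
  induction t with
  | zero => simp; rfl
  | add x y hx hy => simp only [map_add, LinearMap.add_apply, hx, hy, Prod.mk_add_mk]
  | tmul x y =>
    induction v with
    | zero => simp; rfl
    | add v w hv hw => simp only [map_add, hv, hw, Prod.fst_add, Prod.snd_add, Prod.mk_add_mk]
    | tmul m n => rfl

end Algebra

variable [Bialgebra k H]

theorem outerAction_assoc (ρ : H →ₐ[k] Module.End k V) (σ : H →ₐ[k] Module.End k W)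
    (τ : H →ₐ[k] Module.End k U) (a : H) (v : (V ⊗[k] W) ⊗[k] U) :
    TensorProduct.assoc k V W U
        (outerAction ((outerAction ρ σ).comp (Bialgebra.comulAlgHom k H)) τ
          (Coalgebra.comul a) v) =
      outerAction ρ ((outerAction σ τ).comp (Bialgebra.comulAlgHom k H)) (Coalgebra.comul a)
        (TensorProduct.assoc k V W U v) := by
  have hL : ∀ t : H ⊗[k] H,
      outerAction ((outerAction ρ σ).comp (Bialgebra.comulAlgHom k H)) τ t =
        outerAction (outerAction ρ σ) τ ((Coalgebra.comul (R := k) (A := H)).rTensor H t) := by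
    intro t
    induction t with
    | zero => simp
    | add x y hx hy => simp only [map_add, hx, hy]
    | tmul x y => rfl
  have hR : ∀ t : H ⊗[k] H,
      outerAction ρ ((outerAction σ τ).comp (Bialgebra.comulAlgHom k H)) t =
        outerAction ρ (outerAction σ τ) ((Coalgebra.comul (R := k) (A := H)).lTensor H t) := by
    intro t
    induction t with
    | zero => simp
    | add x y hx hy => simp only [map_add, hx, hy]
    | tmul x y => rfl
  have key : ∀ (t : (H ⊗[k] H) ⊗[k] H) (w : (V ⊗[k] W) ⊗[k] U),
      TensorProduct.assoc k V W U (outerAction (outerAction ρ σ) τ t w) =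
        outerAction ρ (outerAction σ τ) (TensorProduct.assoc k H H H t)
          (TensorProduct.assoc k V W U w) := by
    intro t w
    induction t with
    | zero => simp
    | add x y hx hy => simp only [map_add, LinearMap.add_apply, hx, hy]
    | tmul x c =>
      induction x with
      | zero => simp
      | add x y hx hy => simp only [map_add, TensorProduct.add_tmul, LinearMap.add_apply, hx, hy]
      | tmul a b =>
        induction w with
        | zero => simp
        | add v w hv hw => simp only [map_add, hv, hw]
        | tmul z p =>
          induction z with
          | zero => simp
          | add v w hv hw => simp only [map_add, TensorProduct.add_tmul, hv, hw]
          | tmul m n => rfl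
  rw [hL, hR, ← Coalgebra.coassoc_apply]
  exact key _ _

theorem outerAction_lid (σ : H →ₐ[k] Module.End k V) (a : H) (v : k ⊗[k] V) :
    TensorProduct.lid k V
        (outerAction ((Algebra.lmul k k).comp (Bialgebra.counitAlgHom k H)) σ
          (Coalgebra.comul a) v) =
      σ a (TensorProduct.lid k V v) := by
  have key : ∀ (t : H ⊗[k] H) (w : k ⊗[k] V),
      TensorProduct.lid k V
          (outerAction ((Algebra.lmul k k).comp (Bialgebra.counitAlgHom k H)) σ t w) =
        σ (TensorProduct.lid k H ((Coalgebra.counit (R := k) (A := H)).rTensor H t))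
          (TensorProduct.lid k V w) := by
    intro t w
    induction t with
    | zero => simp
    | add x y hx hy => simp only [map_add, LinearMap.add_apply, hx, hy]
    | tmul x y =>
      induction w with
      | zero => simp
      | add v w hv hw => simp only [map_add, hv, hw]
      | tmul c m =>
        rw [outerAction_tmul]
        simp [mul_smul]
        exact smul_comm _ _ _
  rw [key, Coalgebra.rTensor_counit_comul]
  simp

theorem outerAction_rid (σ : H →ₐ[k] Module.End k V) (a : H) (v : V ⊗[k] k) :
    TensorProduct.rid k V
        (outerAction σ ((Algebra.lmul k k).comp (Bialgebra.counitAlgHom k H))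
          (Coalgebra.comul a) v) =
      σ a (TensorProduct.rid k V v) := by
  have key : ∀ (t : H ⊗[k] H) (w : V ⊗[k] k),
      TensorProduct.rid k V
          (outerAction σ ((Algebra.lmul k k).comp (Bialgebra.counitAlgHom k H)) t w) =
        σ (TensorProduct.rid k H ((Coalgebra.counit (R := k) (A := H)).lTensor H t))
          (TensorProduct.rid k V w) := by
    intro t w
    induction t with
    | zero => simp
    | add x y hx hy => simp only [map_add, LinearMap.add_apply, hx, hy]
    | tmul x y =>
      induction w with
      | zero => simp
      | add v w hv hw => simp only [map_add, hv, hw]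
      | tmul m c =>
        rw [outerAction_tmul]
        simp [mul_smul]
        exact smul_comm _ _ _
  rw [key, Coalgebra.lTensor_counit_comul]
  simp

end OuterAction

/-! ## Finite dimensional modules over a bialgebra -/

/-- A finite dimensional left module over the `k`-algebra `H`: a finite dimensional `k`-vector space
together with a `k`-algebra map from `H` to its endomorphism algebra. -/
structure FDModule (k : Type u) [Field k] (H : Type v) [Ring H] [Algebra k H] where
  carrier : Type u
  [addCommGroup : AddCommGroup carrier]
  [module : Module k carrier]
  [finite : Module.Finite k carrier]
  ρ : H →ₐ[k] Module.End k carrier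

namespace FDModule

attribute [instance] FDModule.addCommGroup FDModule.module FDModule.finite

section Algebra

variable {k : Type u} [Field k] {H : Type v} [Ring H] [Algebra k H]

/-- Two `H`-modules are isomorphic if there is a bijective `H`-linear map between them. -/
def Isomorphic (M N : FDModule k H) : Prop :=
  ∃ e : M.carrier ≃ₗ[k] N.carrier, ∀ (a : H) (v : M.carrier), e (M.ρ a v) = N.ρ a (e v)

theorem Isomorphic.refl (M : FDModule k H) : Isomorphic M M :=
  ⟨LinearEquiv.refl k _, fun _ _ => rfl⟩

theorem Isomorphic.symm {M N : FDModule k H} : Isomorphic M N → Isomorphic N M := by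
  rintro ⟨e, he⟩
  refine ⟨e.symm, fun a v => ?_⟩
  rw [LinearEquiv.symm_apply_eq, he, LinearEquiv.apply_symm_apply]

theorem Isomorphic.trans {M N P : FDModule k H} :
    Isomorphic M N → Isomorphic N P → Isomorphic M P := by
  rintro ⟨e, he⟩ ⟨f, hf⟩
  refine ⟨e.trans f, fun a v => ?_⟩
  simp only [LinearEquiv.trans_apply, he, hf]

instance isoSetoid (k : Type u) [Field k] (H : Type v) [Ring H] [Algebra k H] :
    Setoid (FDModule k H) where
  r := Isomorphic
  iseqv := ⟨Isomorphic.refl, Isomorphic.symm, Isomorphic.trans⟩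

/-- The direct sum `M ⊕ N`, with `a • (m, n) = (a • m, a • n)`. -/
def directSum (M N : FDModule k H) : FDModule k H where
  carrier := M.carrier × N.carrier
  ρ := (LinearMap.prodMapAlgHom k M.carrier N.carrier).comp (M.ρ.prod N.ρ)

theorem directSum_ρ (M N : FDModule k H) (a : H) (v : M.carrier × N.carrier) :
    (directSum M N).ρ a v = (M.ρ a v.1, N.ρ a v.2) := rfl

end Algebra

section Bialgebra

variable {k : Type u} [Field k] {H : Type v} [Ring H] [Bialgebra k H]

/-- The tensor product `M ⊗ N` over `k`, on which `a` acts as `Δ(a)`. -/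
noncomputable def tensor (M N : FDModule k H) : FDModule k H where
  carrier := M.carrier ⊗[k] N.carrier
  ρ := (outerAction M.ρ N.ρ).comp (Bialgebra.comulAlgHom k H)

/-- The trivial module `k`, on which `a` acts as `ε(a)`. -/
noncomputable def trivial (k : Type u) [Field k] (H : Type v) [Ring H] [Bialgebra k H] :
    FDModule k H where
  carrier := k
  ρ := (Algebra.lmul k k).comp (Bialgebra.counitAlgHom k H)

theorem tensor_congr {M M' N N' : FDModule k H} :
    Isomorphic M M' → Isomorphic N N' → Isomorphic (tensor M N) (tensor M' N') := by
  rintro ⟨e, he⟩ ⟨f, hf⟩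
  exact ⟨TensorProduct.congr e f, fun a v => outerAction_congr he hf (Coalgebra.comul a) v⟩

theorem tensor_directSum (M N P : FDModule k H) :
    Isomorphic (tensor M (directSum N P)) (directSum (tensor M N) (tensor M P)) :=
  ⟨TensorProduct.prodRight k k M.carrier N.carrier P.carrier,
    fun a v => outerAction_prodRight M.ρ N.ρ P.ρ (Coalgebra.comul a) v⟩

theorem directSum_tensor (M N P : FDModule k H) :
    Isomorphic (tensor (directSum M N) P) (directSum (tensor M P) (tensor N P)) :=
  ⟨TensorProduct.prodLeft k k M.carrier N.carrier P.carrier,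
    fun a v => outerAction_prodLeft M.ρ N.ρ P.ρ (Coalgebra.comul a) v⟩

theorem tensor_assoc (M N P : FDModule k H) :
    Isomorphic (tensor (tensor M N) P) (tensor M (tensor N P)) :=
  ⟨TensorProduct.assoc k M.carrier N.carrier P.carrier,
    fun a v => outerAction_assoc M.ρ N.ρ P.ρ a v⟩

theorem trivial_tensor (M : FDModule k H) : Isomorphic (tensor (trivial k H) M) M :=
  ⟨TensorProduct.lid k M.carrier, fun a v => outerAction_lid M.ρ a v⟩

theorem tensor_trivial (M : FDModule k H) : Isomorphic (tensor M (trivial k H)) M :=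
  ⟨TensorProduct.rid k M.carrier, fun a v => outerAction_rid M.ρ a v⟩

end Bialgebra

end FDModule

/-! ## The Green ring -/

/-- Isomorphism classes of finite dimensional `H`-modules. -/
def IsoClass (k : Type u) [Field k] (H : Type v) [Ring H] [Algebra k H] : Type (max (u + 1) v) :=
  Quotient (FDModule.isoSetoid k H)

namespace IsoClass

/-- The isomorphism class of `M`. -/
def of {k : Type u} [Field k] {H : Type v} [Ring H] [Algebra k H] (M : FDModule k H) :
    IsoClass k H :=
  Quotient.mk _ M

variable {k : Type u} [Field k] {H : Type v} [Ring H] [Bialgebra k H]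

/-- Isomorphism classes form a monoid under the tensor product. -/
noncomputable instance : Monoid (IsoClass k H) where
  mul := Quotient.map₂ FDModule.tensor fun _ _ h₁ _ _ h₂ => FDModule.tensor_congr h₁ h₂
  one := of (FDModule.trivial k H)
  mul_assoc := by
    rintro ⟨M⟩ ⟨N⟩ ⟨P⟩
    exact Quotient.sound (FDModule.tensor_assoc M N P)
  one_mul := by
    rintro ⟨M⟩
    exact Quotient.sound (FDModule.trivial_tensor M)
  mul_one := by
    rintro ⟨M⟩
    exact Quotient.sound (FDModule.tensor_trivial M)

theorem of_mul_of (M N : FDModule k H) : of M * of N = of (FDModule.tensor M N) := rfl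

theorem of_eq_of {M N : FDModule k H} : of M = of N ↔ FDModule.Isomorphic M N := Quotient.eq

theorem exists_of (x : IsoClass k H) : ∃ M, of M = x := Quotient.exists_rep x

end IsoClass

section GreenRing

variable (k : Type u) [Field k] (H : Type v) [Ring H]

/-- The subgroup of the free abelian group on the isomorphism classes of finite dimensional modules
that is generated by the elements `[M ⊕ N] - [M] - [N]`. -/
def greenRelations [Algebra k H] : AddSubgroup (FreeAbelianGroup (IsoClass k H)) :=
  AddSubgroup.closure (Set.range fun p : FDModule k H × FDModule k H =>
    FreeAbelianGroup.of (IsoClass.of (FDModule.directSum p.1 p.2))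
      - FreeAbelianGroup.of (IsoClass.of p.1) - FreeAbelianGroup.of (IsoClass.of p.2))

variable [Bialgebra k H]

theorem mul_mem_greenRelations_left (x : FreeAbelianGroup (IsoClass k H))
    {y : FreeAbelianGroup (IsoClass k H)} (hy : y ∈ greenRelations k H) :
    x * y ∈ greenRelations k H := by
  induction x using FreeAbelianGroup.induction_on with
  | zero => simp [zero_mem]
  | neg x hx => rw [neg_mul]; exact neg_mem hx
  | add x x' hx hx' => rw [add_mul]; exact add_mem hx hx'
  | of x =>
    obtain ⟨M, rfl⟩ := x.exists_of
    induction hy using AddSubgroup.closure_induction with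
    | zero => simp [zero_mem]
    | neg y _ hy => rw [mul_neg]; exact neg_mem hy
    | add y y' _ _ hy hy' => rw [mul_add]; exact add_mem hy hy'
    | mem y hy =>
      obtain ⟨⟨N, P⟩, rfl⟩ := hy
      simp only [mul_sub, FreeAbelianGroup.of_mul_of, IsoClass.of_mul_of]
      rw [IsoClass.of_eq_of.2 (FDModule.tensor_directSum M N P)]
      exact AddSubgroup.subset_closure ⟨(_, _), rfl⟩

theorem mul_mem_greenRelations_right (x : FreeAbelianGroup (IsoClass k H))
    {y : FreeAbelianGroup (IsoClass k H)} (hy : y ∈ greenRelations k H) :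
    y * x ∈ greenRelations k H := by
  induction x using FreeAbelianGroup.induction_on with
  | zero => simp [zero_mem]
  | neg x hx => rw [mul_neg]; exact neg_mem hx
  | add x x' hx hx' => rw [mul_add]; exact add_mem hx hx'
  | of x =>
    obtain ⟨M, rfl⟩ := x.exists_of
    induction hy using AddSubgroup.closure_induction with
    | zero => simp [zero_mem]
    | neg y _ hy => rw [neg_mul]; exact neg_mem hy
    | add y y' _ _ hy hy' => rw [add_mul]; exact add_mem hy hy'
    | mem y hy =>
      obtain ⟨⟨N, P⟩, rfl⟩ := hy
      simp only [sub_mul, FreeAbelianGroup.of_mul_of, IsoClass.of_mul_of]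
      rw [IsoClass.of_eq_of.2 (FDModule.directSum_tensor N P M)]
      exact AddSubgroup.subset_closure ⟨(_, _), rfl⟩

/-- The subgroup `greenRelations` as a two-sided ideal. -/
noncomputable def greenIdeal : TwoSidedIdeal (FreeAbelianGroup (IsoClass k H)) :=
  TwoSidedIdeal.mk' (greenRelations k H) (zero_mem _) add_mem neg_mem
    (fun h => mul_mem_greenRelations_left k H _ h) (fun h => mul_mem_greenRelations_right k H _ h)

/-- The Green ring `r(H)`: the free abelian group on the isomorphism classes of finite dimensional
`H`-modules modulo the relations `[M ⊕ N] = [M] + [N]`, with product `[M][N] = [M ⊗ N]`. -/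
def GreenRing : Type (max (u + 1) v) := (greenIdeal k H).ringCon.Quotient

noncomputable instance : Ring (GreenRing k H) :=
  inferInstanceAs (Ring (greenIdeal k H).ringCon.Quotient)

/-- The class `[M]` in the Green ring. -/
noncomputable def GreenRing.mk (M : FDModule k H) : GreenRing k H :=
  (greenIdeal k H).ringCon.mk' (FreeAbelianGroup.of (IsoClass.of M))

theorem GreenRing.mk_directSum (M N : FDModule k H) :
    GreenRing.mk k H (FDModule.directSum M N) = GreenRing.mk k H M + GreenRing.mk k H N := by
  refine (Quotient.sound ?_ : _ = (greenIdeal k H).ringCon.mk'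
    (FreeAbelianGroup.of (IsoClass.of M) + FreeAbelianGroup.of (IsoClass.of N)))
  change _ - (_ + _) ∈ greenRelations k H
  rw [← sub_sub]
  exact AddSubgroup.subset_closure ⟨(M, N), rfl⟩

theorem GreenRing.mk_tensor (M N : FDModule k H) :
    GreenRing.mk k H (FDModule.tensor M N) = GreenRing.mk k H M * GreenRing.mk k H N := by
  unfold GreenRing.mk
  rw [← IsoClass.of_mul_of, FreeAbelianGroup.of_mul]
  rfl

end GreenRing

/-! ## The Taft algebra -/

/-- The defining relations of the Taft algebra: `g ^ n = 1`, `h ^ n = 0` and `h g = q g h`, where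
`g` and `h` are the free generators with index `0` and `1`. -/
inductive TaftRel (k : Type u) [Field k] (n : ℕ) (q : k) :
    FreeAlgebra k (Fin 2) → FreeAlgebra k (Fin 2) → Prop
  | g_pow : TaftRel k n q (FreeAlgebra.ι k 0 ^ n) 1
  | h_pow : TaftRel k n q (FreeAlgebra.ι k 1 ^ n) 0
  | h_mul_g : TaftRel k n q (FreeAlgebra.ι k 1 * FreeAlgebra.ι k 0)
      (q • (FreeAlgebra.ι k 0 * FreeAlgebra.ι k 1))

/-- The Taft algebra `H_n(q)`, as an algebra by generators and relations. -/
def TaftAlgebra (k : Type u) [Field k] (n : ℕ) (q : k) : Type u := RingQuot (TaftRel k n q)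

namespace TaftAlgebra

section Algebra

variable (k : Type u) [Field k] (n : ℕ) (q : k)

noncomputable instance : Ring (TaftAlgebra k n q) :=
  inferInstanceAs (Ring (RingQuot (TaftRel k n q)))

noncomputable instance : Algebra k (TaftAlgebra k n q) :=
  inferInstanceAs (Algebra k (RingQuot (TaftRel k n q)))

/-- The generator `g`. -/
noncomputable def g : TaftAlgebra k n q :=
  RingQuot.mkAlgHom k (TaftRel k n q) (FreeAlgebra.ι k 0)

/-- The generator `h`. -/
noncomputable def h : TaftAlgebra k n q :=
  RingQuot.mkAlgHom k (TaftRel k n q) (FreeAlgebra.ι k 1)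

theorem g_pow : g k n q ^ n = 1 := by
  have := RingQuot.mkAlgHom_rel k (TaftRel.g_pow (k := k) (n := n) (q := q))
  rw [map_pow, map_one] at this
  exact this

theorem h_pow : h k n q ^ n = 0 := by
  have := RingQuot.mkAlgHom_rel k (TaftRel.h_pow (k := k) (n := n) (q := q))
  rw [map_pow, map_zero] at this
  exact this

theorem h_mul_g : h k n q * g k n q = q • (g k n q * h k n q) := by
  have := RingQuot.mkAlgHom_rel k (TaftRel.h_mul_g (k := k) (n := n) (q := q))
  rw [map_mul, map_smul, map_mul] at this
  exact this

theorem h_mul_g_pow (m : ℕ) : h k n q * g k n q ^ m = q ^ m • (g k n q ^ m * h k n q) := by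
  induction m with
  | zero => simp
  | succ m ih =>
    rw [pow_succ, ← mul_assoc, ih, smul_mul_assoc, mul_assoc, h_mul_g, mul_smul_comm, smul_smul,
      ← mul_assoc, ← pow_succ]

theorem exists_g_pow_mul_h_pow (m j : ℕ) :
    ∃ c : k, (g k n q ^ m * h k n q) ^ j = c • (g k n q ^ (m * j) * h k n q ^ j) := by
  induction j with
  | zero => exact ⟨1, by simp⟩
  | succ j ih =>
    obtain ⟨c, hc⟩ := ih
    refine ⟨q ^ (m * j) * c, ?_⟩
    rw [pow_succ', hc, mul_smul_comm, mul_assoc, ← mul_assoc (h k n q), h_mul_g_pow,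
      smul_mul_assoc, mul_smul_comm, smul_smul, mul_assoc, ← pow_succ', ← mul_assoc, ← pow_add,
      mul_comm c, Nat.mul_succ, Nat.add_comm m]

variable {k n q} {A : Type*} [Ring A] [Algebra k A]

/-- Algebra maps out of the Taft algebra: give the images of `g` and `h` and check the relations. -/
noncomputable def lift (a b : A) (ha : a ^ n = 1) (hb : b ^ n = 0) (hba : b * a = q • (a * b)) :
    TaftAlgebra k n q →ₐ[k] A :=
  RingQuot.liftAlgHom k ⟨FreeAlgebra.lift k ![a, b], by
    rintro _ _ (_ | _ | _) <;> simp [ha, hb, hba]⟩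

theorem lift_g (a b : A) (ha : a ^ n = 1) (hb : b ^ n = 0) (hba : b * a = q • (a * b)) :
    lift a b ha hb hba (g k n q) = a := by
  refine (RingQuot.liftAlgHom_mkAlgHom_apply k _ _ _).trans ?_
  simp

theorem lift_h (a b : A) (ha : a ^ n = 1) (hb : b ^ n = 0) (hba : b * a = q • (a * b)) :
    lift a b ha hb hba (h k n q) = b := by
  refine (RingQuot.liftAlgHom_mkAlgHom_apply k _ _ _).trans ?_
  simp

theorem algHom_ext {φ ψ : TaftAlgebra k n q →ₐ[k] A} (hg : φ (g k n q) = ψ (g k n q))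
    (hh : φ (h k n q) = ψ (h k n q)) : φ = ψ := by
  refine RingQuot.ringQuot_ext' k φ ψ (FreeAlgebra.hom_ext (funext fun i => ?_))
  fin_cases i
  · exact hg
  · exact hh

/-- To prove a property of all elements, prove it for scalars and generators, sums and products. -/
theorem induction {P : TaftAlgebra k n q → Prop}
    (scalar : ∀ c : k, P (algebraMap k _ c)) (hg : P (g k n q)) (hh : P (h k n q))
    (add : ∀ x y, P x → P y → P (x + y)) (mul : ∀ x y, P x → P y → P (x * y))
    (x : TaftAlgebra k n q) : P x := by
  obtain ⟨y, rfl⟩ := RingQuot.mkAlgHom_surjective k (TaftRel k n q) x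
  induction y using FreeAlgebra.induction with
  | grade0 r => rw [AlgHom.commutes]; exact scalar r
  | grade1 i =>
    fin_cases i
    · exact hg
    · exact hh
  | mul x y hx hy => rw [map_mul]; exact mul _ _ hx hy
  | add x y hx hy => rw [map_add]; exact add _ _ hx hy

end Algebra

section QBinomial

variable {k : Type*} [Field k]

/-- The `q`-binomial coefficients, by `[m+1, i+1] = [m, i] + q ^ (i+1) [m, i+1]`. -/
def qBinom (q : k) : ℕ → ℕ → k
  | _, 0 => 1
  | 0, _ + 1 => 0
  | m + 1, i + 1 => qBinom q m i + q ^ (i + 1) * qBinom q m (i + 1)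

theorem qBinom_zero (q : k) (m : ℕ) : qBinom q m 0 = 1 := by cases m <;> rfl

theorem qBinom_succ_succ (q : k) (m i : ℕ) :
    qBinom q (m + 1) (i + 1) = qBinom q m i + q ^ (i + 1) * qBinom q m (i + 1) := rfl

theorem qBinom_of_lt (q : k) : ∀ {m i : ℕ}, m < i → qBinom q m i = 0
  | _, 0, hi => absurd hi (Nat.not_lt_zero _)
  | 0, _ + 1, _ => rfl
  | m + 1, i + 1, hi => by
    rw [qBinom_succ_succ, qBinom_of_lt q (by omega), qBinom_of_lt q (by omega)]; simp

theorem qBinom_mul (q : k) (m i : ℕ) :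
    qBinom q (m + 1) (i + 1) * (∑ j ∈ Finset.range (i + 1), q ^ j) =
      (∑ j ∈ Finset.range (m + 1), q ^ j) * qBinom q m i := by
  induction m generalizing i with
  | zero =>
    cases i with
    | zero => simp [qBinom]
    | succ i => simp [qBinom]
  | succ m ih =>
    rw [qBinom_succ_succ, add_mul, mul_assoc, ih i, Finset.sum_range_succ' _ (m + 1)]
    cases i with
    | zero =>
      simp only [qBinom_zero, pow_succ, ← Finset.sum_mul]
      simp
      ring
    | succ i =>
      rw [Finset.sum_range_succ' _ (i + 1)]
      simp only [pow_succ q (_ : ℕ), ← Finset.sum_mul]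
      have h1 := ih i
      have h2 := qBinom_succ_succ q m i
      simp only [pow_succ] at h2 ⊢
      linear_combination q * h1 - q * (∑ j ∈ Finset.range (m + 1), q ^ j) * h2

/-- The `q`-binomial theorem. -/
theorem add_pow_of_qComm {A : Type*} [Ring A] [Algebra k A] {q : k} {a b : A}
    (hab : a * b = q • (b * a)) (m : ℕ) :
    (a + b) ^ m = ∑ i ∈ Finset.range (m + 1), qBinom q m i • (b ^ i * a ^ (m - i)) := by
  have hpow : ∀ i, a * b ^ i = q ^ i • (b ^ i * a) := by
    intro i
    induction i with
    | zero => simp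
    | succ i ih =>
      rw [pow_succ, ← mul_assoc, ih, smul_mul_assoc, mul_assoc, hab, mul_smul_comm, smul_smul,
        ← mul_assoc, ← pow_succ]
  induction m with
  | zero => simp [qBinom]
  | succ m ih =>
    rw [pow_succ', ih, add_mul, Finset.mul_sum, Finset.mul_sum, Finset.sum_range_succ' _ (m + 1)]
    simp only [qBinom_succ_succ, add_smul, Finset.sum_add_distrib]
    rw [add_comm, add_assoc]
    congr 1
    · refine Finset.sum_congr rfl fun i _ => ?_
      rw [mul_smul_comm, ← mul_assoc, ← pow_succ', Nat.add_sub_add_right]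
    · have h0 : qBinom q m (m + 1) = 0 := qBinom_of_lt q (Nat.lt_succ_self m)
      rw [Finset.sum_range_succ
          (fun x => (q ^ (x + 1) * qBinom q m (x + 1)) • (b ^ (x + 1) * a ^ (m + 1 - (x + 1)))) m,
        h0, Finset.sum_range_succ']
      simp only [mul_zero, zero_smul, add_zero, qBinom_zero]
      congr 1
      · refine Finset.sum_congr rfl fun i hi => ?_
        have hi' : m - i = m - (i + 1) + 1 := by
          have := Finset.mem_range.1 hi
          omega
        rw [mul_smul_comm, ← mul_assoc, hpow, smul_mul_assoc, smul_smul, mul_assoc, ← pow_succ',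
          Nat.add_sub_add_right, hi', mul_comm]
      · simp [pow_succ']

theorem add_pow_of_isPrimitiveRoot {A : Type*} [Ring A] [Algebra k A] {q : k} {n : ℕ} [NeZero n]
    (hq : IsPrimitiveRoot q n) {a b : A} (hab : a * b = q • (b * a)) :
    (a + b) ^ n = a ^ n + b ^ n := by
  obtain ⟨n, rfl⟩ : ∃ m, n = m + 1 := ⟨n - 1, by have := NeZero.pos n; omega⟩
  have hz : ∀ i, i < n → qBinom q (n + 1) (i + 1) = 0 := by
    intro i hi
    have h1 := qBinom_mul q n i
    have h2 : (∑ j ∈ Finset.range (n + 1), q ^ j) = 0 := hq.geom_sum_eq_zero (by omega)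
    have h3 : (∑ j ∈ Finset.range (i + 1), q ^ j) ≠ 0 := by
      intro h0
      have h4 := mul_geom_sum q (i + 1)
      rw [h0, mul_zero] at h4
      exact hq.pow_ne_one_of_pos_of_lt (by omega) (by omega) (sub_eq_zero.1 h4.symm)
    rw [h2, zero_mul] at h1
    exact (mul_eq_zero.1 h1).resolve_right h3
  have hd : ∀ m, qBinom q m m = 1 := by
    intro m
    induction m with
    | zero => rfl
    | succ m ih => rw [qBinom_succ_succ, ih, qBinom_of_lt q (Nat.lt_succ_self m)]; simp
  rw [add_pow_of_qComm hab, Finset.sum_range_succ, Finset.sum_range_succ', hd, qBinom_zero,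
    Finset.sum_eq_zero]
  · simp
  · intro i hi
    rw [hz i (Finset.mem_range.1 hi), zero_smul]

end QBinomial

section Hopf

variable (k : Type u) [Field k] (n : ℕ) [NeZero n] (q : k) [hq : Fact (IsPrimitiveRoot q n)]

/-- The comultiplication, with `Δ(g) = g ⊗ g` and `Δ(h) = 1 ⊗ h + h ⊗ g`. -/
noncomputable def comulHom : TaftAlgebra k n q →ₐ[k] TaftAlgebra k n q ⊗[k] TaftAlgebra k n q :=
  lift (g k n q ⊗ₜ g k n q) (1 ⊗ₜ h k n q + h k n q ⊗ₜ g k n q)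
    (by rw [Algebra.TensorProduct.tmul_pow, g_pow, Algebra.TensorProduct.one_def])
    (by
      have hn : n ≠ 0 := NeZero.ne n
      rw [add_pow_of_isPrimitiveRoot hq.out]
      · rw [Algebra.TensorProduct.tmul_pow, Algebra.TensorProduct.tmul_pow, h_pow,
          TensorProduct.tmul_zero, TensorProduct.zero_tmul, add_zero]
      · simp only [Algebra.TensorProduct.tmul_mul_tmul, one_mul, mul_one, h_mul_g,
          TensorProduct.tmul_smul])
    (by
      simp only [add_mul, mul_add, Algebra.TensorProduct.tmul_mul_tmul, one_mul, mul_one, h_mul_g,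
        TensorProduct.tmul_smul, smul_add, TensorProduct.smul_tmul'])

/-- The counit, with `ε(g) = 1` and `ε(h) = 0`. -/
noncomputable def counitHom : TaftAlgebra k n q →ₐ[k] k :=
  lift 1 0 (one_pow n) (zero_pow (NeZero.ne n)) (by simp)

noncomputable instance : Bialgebra k (TaftAlgebra k n q) :=
  Bialgebra.ofAlgHom (comulHom k n q) (counitHom k n q)
    (by
      apply algHom_ext <;>
        simp [comulHom, lift_g, lift_h, TensorProduct.add_tmul, TensorProduct.tmul_add,
          Algebra.TensorProduct.one_def, add_assoc])
    (by
      apply algHom_ext <;>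
        simp [comulHom, counitHom, lift_g, lift_h])
    (by
      apply algHom_ext <;>
        simp [comulHom, counitHom, lift_g, lift_h])

theorem comul_g : Coalgebra.comul (R := k) (g k n q) = g k n q ⊗ₜ[k] g k n q :=
  lift_g ..

theorem comul_h :
    Coalgebra.comul (R := k) (h k n q) = 1 ⊗ₜ[k] h k n q + h k n q ⊗ₜ[k] g k n q :=
  lift_h ..

theorem counit_g : Coalgebra.counit (R := k) (g k n q) = 1 := lift_g ..

theorem counit_h : Coalgebra.counit (R := k) (h k n q) = 0 := lift_h ..

/-- The antipode as an algebra map to the opposite algebra, with `S(g) = g ^ (n - 1)` and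
`S(h) = - q⁻¹ g ^ (n - 1) h`. -/
noncomputable def antipodeHom : TaftAlgebra k n q →ₐ[k] (TaftAlgebra k n q)ᵐᵒᵖ :=
  lift (MulOpposite.op (g k n q ^ (n - 1)))
    (MulOpposite.op (-(q⁻¹ • (g k n q ^ (n - 1) * h k n q))))
    (by rw [← MulOpposite.op_pow, ← pow_mul, mul_comm, pow_mul, g_pow, one_pow, MulOpposite.op_one])
    (by
      obtain ⟨c, hc⟩ := exists_g_pow_mul_h_pow k n q (n - 1) n
      rw [← MulOpposite.op_pow, ← neg_smul, smul_pow, hc, h_pow, mul_zero, smul_zero, smul_zero,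
        MulOpposite.op_zero])
    (by
      have hn : q ^ (n - 1) * q = 1 := by
        rw [pow_sub_one_mul (NeZero.ne n), hq.out.pow_eq_one]
      rw [← MulOpposite.op_mul, ← MulOpposite.op_mul, ← MulOpposite.op_smul]
      congr 1
      rw [neg_mul, mul_neg, smul_neg, smul_mul_assoc, mul_smul_comm, mul_assoc (g k n q ^ (n - 1)),
        h_mul_g_pow, mul_smul_comm, smul_smul, smul_smul]
      congr 2
      linear_combination (-q⁻¹) * hn)

/-- The antipode. -/
noncomputable def antipodeMap : TaftAlgebra k n q →ₗ[k] TaftAlgebra k n q :=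
  (MulOpposite.opLinearEquiv k).symm.toLinearMap ∘ₗ (antipodeHom k n q).toLinearMap

theorem antipodeMap_algebraMap (c : k) :
    antipodeMap k n q (algebraMap k _ c) = algebraMap k _ c := by
  simp [antipodeMap]

theorem antipodeMap_mul (x y : TaftAlgebra k n q) :
    antipodeMap k n q (x * y) = antipodeMap k n q y * antipodeMap k n q x := by
  simp [antipodeMap]

theorem antipodeMap_g : antipodeMap k n q (g k n q) = g k n q ^ (n - 1) := by
  simp [antipodeMap, antipodeHom, lift_g]

theorem antipodeMap_h :
    antipodeMap k n q (h k n q) = -(q⁻¹ • (g k n q ^ (n - 1) * h k n q)) := by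
  simp [antipodeMap, antipodeHom, lift_h]

theorem antipode_rTensor (x : TaftAlgebra k n q) :
    LinearMap.mul' k _ ((antipodeMap k n q).rTensor _ (Coalgebra.comul x)) =
      algebraMap k _ (Coalgebra.counit x) := by
  have hq0 : q ≠ 0 := hq.out.ne_zero (NeZero.ne n)
  induction x using induction with
  | scalar c => simp [Algebra.TensorProduct.algebraMap_apply, antipodeMap_algebraMap]
  | hg => simp [comul_g, counit_g, antipodeMap_g, pow_sub_one_mul (NeZero.ne n), g_pow]
  | hh =>
    have h1 : antipodeMap k n q 1 = 1 := by simpa using antipodeMap_algebraMap k n q 1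
    simp only [comul_h, counit_h, map_add, LinearMap.rTensor_tmul, LinearMap.mul'_apply, h1,
      antipodeMap_h, map_zero, one_mul, neg_mul, smul_mul_assoc]
    rw [mul_assoc, h_mul_g, mul_smul_comm, smul_smul, inv_mul_cancel₀ hq0, one_smul, ← mul_assoc,
      pow_sub_one_mul (NeZero.ne n), g_pow, one_mul, add_neg_cancel]
  | add x y hx hy => simp only [map_add, hx, hy]
  | mul x y hx hy =>
    rw [Bialgebra.comul_mul, Bialgebra.counit_mul, map_mul (algebraMap k (TaftAlgebra k n q)), ← hy]
    generalize (Coalgebra.comul y : TaftAlgebra k n q ⊗[k] TaftAlgebra k n q) = s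
    induction s with
    | zero => simp
    | add s s' hs hs' => simp only [mul_add, map_add, hs, hs']
    | tmul c d =>
      have key : ∀ t : TaftAlgebra k n q ⊗[k] TaftAlgebra k n q,
          LinearMap.mul' k _ ((antipodeMap k n q).rTensor _ (t * (c ⊗ₜ d))) =
            antipodeMap k n q c * LinearMap.mul' k _ ((antipodeMap k n q).rTensor _ t) * d := by
        intro t
        induction t with
        | zero => simp
        | add t t' ht ht' => simp only [add_mul, mul_add, map_add, ht, ht']
        | tmul a b =>
          simp only [Algebra.TensorProduct.tmul_mul_tmul, LinearMap.rTensor_tmul,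
            LinearMap.mul'_apply, antipodeMap_mul, mul_assoc]
      rw [key, hx, ← Algebra.commutes]
      simp only [LinearMap.rTensor_tmul, LinearMap.mul'_apply, mul_assoc]

theorem antipode_lTensor (x : TaftAlgebra k n q) :
    LinearMap.mul' k _ ((antipodeMap k n q).lTensor _ (Coalgebra.comul x)) =
      algebraMap k _ (Coalgebra.counit x) := by
  have hq0 : q ≠ 0 := hq.out.ne_zero (NeZero.ne n)
  induction x using induction with
  | scalar c =>
    have h1 : antipodeMap k n q 1 = 1 := by simpa using antipodeMap_algebraMap k n q 1
    simp [Algebra.TensorProduct.algebraMap_apply, h1]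
  | hg => simp [comul_g, counit_g, antipodeMap_g, mul_pow_sub_one (NeZero.ne n), g_pow]
  | hh =>
    have hn : q ^ (n - 1) = q⁻¹ := by
      apply eq_inv_of_mul_eq_one_left
      rw [pow_sub_one_mul (NeZero.ne n), hq.out.pow_eq_one]
    simp only [comul_h, counit_h, map_add, LinearMap.lTensor_tmul, LinearMap.mul'_apply,
      antipodeMap_h, antipodeMap_g, map_zero, one_mul, h_mul_g_pow, hn, neg_add_cancel]
  | add x y hx hy => simp only [map_add, hx, hy]
  | mul x y hx hy =>
    rw [Bialgebra.comul_mul, Bialgebra.counit_mul, map_mul (algebraMap k (TaftAlgebra k n q)), ← hx]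
    generalize (Coalgebra.comul x : TaftAlgebra k n q ⊗[k] TaftAlgebra k n q) = t
    induction t with
    | zero => simp
    | add t t' ht ht' => simp only [add_mul, map_add, ht, ht']
    | tmul a b =>
      have key : ∀ s : TaftAlgebra k n q ⊗[k] TaftAlgebra k n q,
          LinearMap.mul' k _ ((antipodeMap k n q).lTensor _ ((a ⊗ₜ b) * s)) =
            a * LinearMap.mul' k _ ((antipodeMap k n q).lTensor _ s) * antipodeMap k n q b := by
        intro s
        induction s with
        | zero => simp
        | add s s' hs hs' => simp only [add_mul, mul_add, map_add, hs, hs']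
        | tmul c d =>
          simp only [Algebra.TensorProduct.tmul_mul_tmul, LinearMap.lTensor_tmul,
            LinearMap.mul'_apply, antipodeMap_mul, mul_assoc]
      rw [key, hy, mul_assoc, Algebra.commutes]
      simp only [LinearMap.lTensor_tmul, LinearMap.mul'_apply, mul_assoc]

noncomputable instance : HopfAlgebra k (TaftAlgebra k n q) where
  antipode := antipodeMap k n q
  mul_antipode_rTensor_comul := LinearMap.ext (antipode_rTensor k n q)
  mul_antipode_lTensor_comul := LinearMap.ext (antipode_lTensor k n q)

end Hopf

end TaftAlgebra

/-! ## Splitting modules and the additive structure of the Green ring -/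

/-! Say that an eigenvector of $g$ has weight $s$ if its eigenvalue is $q^{-s}$; by $hg=qgh$, $h$
raises weights by one. Let $V_{l,r}$, for $1\le l\le n$ and $r$ modulo $n$, be the module with basis
$v,hv,\dots,h^{l-1}v$, where $h^lv=0$ and $v$ has weight $r$.

Every finite dimensional module is a direct sum of such modules. If $h$ has nilpotency index $a+1$
on $V$, some weight vector $v$ has $h^av\ne0$, and the submodule it generates is a direct summand
(`exists_cyc_directSum_isomorphic`, `exists_summand`). The multiplicities are differences of ranks
of powers of $h$ times weight projections. These ranks are additive on direct sums, so no
Krull-Schmidt theorem is needed, and the $n^2$ classes $[V_{l,r}]$ form a $\mathbb Z$-basis of the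
Green ring (`span_cycClass`, `linearIndependent_cycClass`).

Put $y=[V_{1,1}]$ and $z=[V_{2,0}]$. Explicit generators in tensor products give
$y[V_{l,r}]=[V_{l,r+1}]$, $z[V_{l,0}]=[V_{l+1,0}]+y[V_{l-1,0}]$ for $2\le l<n$, and
$z[V_{n,0}]=(1+y)[V_{n,0}]$. With $f_0=0$, $f_1=1$, $f_{m+2}=zf_{m+1}-yf_m$ this says
$[V_{l,r}]=y^rf_l$, together with $y^n=1$ and $(z-y-1)f_n=0$. In the ring presented by these two
relations the $n^2$ elements $y^rf_l$ still span, and they map to a basis of the Green ring, so the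
map is an isomorphism. The argument works for every $n\ge2$; the listed polynomials are the $f_n$
written out. -/

namespace FDModule

variable {k : Type u} [Field k] {H : Type v} [Ring H] [Algebra k H]

/-- The submodule of `M` carried by the invariant subspace `S`. -/
def ofInvariant (M : FDModule k H) (S : Submodule k M.carrier)
    (hS : ∀ a, ∀ v ∈ S, M.ρ a v ∈ S) : FDModule k H where
  carrier := S
  ρ :=
    { toFun := fun a => (M.ρ a).restrict (hS a)
      map_one' := by ext; simp
      map_mul' := fun a b => by ext; simp
      map_zero' := by ext; simp
      map_add' := fun a b => by ext; simp
      commutes' := fun c => by ext; simp }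

/-- A retraction `β` of `α` splits the space as the source of `α` plus the kernel of `β`. -/
def retractEquiv {M V : Type*} [AddCommGroup M] [Module k M] [AddCommGroup V] [Module k V]
    (α : M →ₗ[k] V) (β : V →ₗ[k] M) (hβα : ∀ v, β (α v) = v) :
    (M × LinearMap.ker β) ≃ₗ[k] V :=
  { α.coprod (LinearMap.ker β).subtype with
    invFun := fun v => (β v, ⟨v - α (β v), by simp [hβα]⟩)
    left_inv := by
      rintro ⟨m, v, hv⟩
      have hv' : β v = 0 := hv
      refine Prod.ext ?_ (Subtype.ext ?_) <;> simp [hβα, hv']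
    right_inv := fun v => by simp }

/-- A retract of a module is a direct summand. -/
theorem exists_isomorphic_directSum_of_retract {M V : FDModule k H}
    (α : M.carrier →ₗ[k] V.carrier) (β : V.carrier →ₗ[k] M.carrier)
    (hα : ∀ a v, α (M.ρ a v) = V.ρ a (α v)) (hβ : ∀ a v, β (V.ρ a v) = M.ρ a (β v))
    (hβα : ∀ v, β (α v) = v) :
    ∃ K : FDModule k H, Isomorphic (directSum M K) V := by
  refine ⟨V.ofInvariant (LinearMap.ker β) fun a v hv => ?_, retractEquiv α β hβα, ?_⟩
  · rw [LinearMap.mem_ker] at hv ⊢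
    rw [hβ, hv, map_zero]
  · intro a (v : M.carrier × LinearMap.ker β)
    change α (M.ρ a v.1) + V.ρ a v.2 = V.ρ a (α v.1 + v.2)
    rw [map_add, hα]

theorem finrank_directSum (M N : FDModule k H) :
    Module.finrank k (directSum M N).carrier =
      Module.finrank k M.carrier + Module.finrank k N.carrier :=
  Module.finrank_prod

theorem Isomorphic.finrank_eq {M N : FDModule k H} (h : Isomorphic M N) :
    Module.finrank k M.carrier = Module.finrank k N.carrier := by
  obtain ⟨e, -⟩ := h
  exact e.finrank_eq

/-- The rank of the action of `a`. -/
noncomputable def rankAct (a : H) (M : FDModule k H) : ℕ :=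
  Module.finrank k (LinearMap.range (M.ρ a))

theorem Isomorphic.rankAct_eq {M N : FDModule k H} (h : Isomorphic M N) (a : H) :
    rankAct a M = rankAct a N := by
  obtain ⟨e, he⟩ := h
  have : LinearMap.range (N.ρ a) = (LinearMap.range (M.ρ a)).map e.toLinearMap := by
    ext w
    constructor
    · rintro ⟨v, rfl⟩
      exact ⟨M.ρ a (e.symm v), ⟨_, rfl⟩, by simp [he]⟩
    · rintro ⟨_, ⟨v, rfl⟩, rfl⟩
      exact ⟨e v, (he a v).symm⟩
  rw [rankAct, rankAct, this]
  exact (e.submoduleMap _).finrank_eq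

theorem _root_.Submodule.finrank_prod {M N : Type*} [AddCommGroup M] [Module k M]
    [Module.Finite k M] [AddCommGroup N] [Module k N] [Module.Finite k N]
    (S : Submodule k M) (T : Submodule k N) :
    Module.finrank k (S.prod T) = Module.finrank k S + Module.finrank k T := by
  rw [← Module.finrank_prod]
  exact LinearEquiv.finrank_eq
    { toFun := fun x => (⟨x.1.1, x.2.1⟩, ⟨x.1.2, x.2.2⟩)
      map_add' := fun _ _ => rfl
      map_smul' := fun _ _ => rfl
      invFun := fun x => ⟨(x.1, x.2), x.1.2, x.2.2⟩
      left_inv := fun _ => rfl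
      right_inv := fun _ => rfl }

theorem rankAct_directSum (a : H) (M N : FDModule k H) :
    rankAct a (directSum M N) = rankAct a M + rankAct a N := by
  have : LinearMap.range ((directSum M N).ρ a) =
      (LinearMap.range (M.ρ a)).prod (LinearMap.range (N.ρ a)) :=
    LinearMap.range_prodMap ..
  rw [rankAct, this]
  exact Submodule.finrank_prod _ _

end FDModule

/-! ### Additive maps out of the Green ring -/

namespace GreenRing

variable {k : Type u} [Field k] {H : Type v} [Ring H] [Bialgebra k H]

theorem mk_eq_of_isomorphic {M N : FDModule k H} (h : FDModule.Isomorphic M N) :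
    GreenRing.mk k H M = GreenRing.mk k H N := by
  rw [GreenRing.mk, GreenRing.mk, IsoClass.of_eq_of.2 h]

theorem mk_trivial : GreenRing.mk k H (FDModule.trivial k H) = 1 := rfl

/-- A zero module satisfies $M\oplus M\cong M$, whence $2[M]=[M]$. -/
theorem mk_eq_zero_of_subsingleton (M : FDModule k H) [Subsingleton M.carrier] :
    GreenRing.mk k H M = 0 := by
  have h : FDModule.Isomorphic (FDModule.directSum M M) M :=
    ⟨{ LinearMap.fst k M.carrier M.carrier with
        invFun := fun v => (v, v)
        left_inv := fun _ => Prod.ext (Subsingleton.elim _ _) (Subsingleton.elim _ _)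
        right_inv := fun _ => Subsingleton.elim _ _ }, fun _ _ => Subsingleton.elim _ _⟩
  have := mk_eq_of_isomorphic h
  rw [GreenRing.mk_directSum] at this
  simpa using this

/-- The classes of modules generate the Green ring additively. -/
theorem induction {P : GreenRing k H → Prop} (mk : ∀ M, P (GreenRing.mk k H M))
    (zero : P 0) (add : ∀ x y, P x → P y → P (x + y)) (neg : ∀ x, P x → P (-x))
    (x : GreenRing k H) : P x := by
  obtain ⟨y, rfl⟩ := (greenIdeal k H).ringCon.mk'_surjective x
  induction y using FreeAbelianGroup.induction_on with
  | zero => rw [map_zero]; exact zero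
  | of c => obtain ⟨M, rfl⟩ := c.exists_of; exact mk M
  | neg c h => rw [map_neg]; exact neg _ h
  | add a b ha hb => rw [map_add]; exact add _ _ ha hb

/-- An isomorphism invariant that is additive on direct sums extends to the Green ring. -/
noncomputable def liftAdd (r : FDModule k H → ℤ)
    (hr : ∀ M N, FDModule.Isomorphic M N → r M = r N)
    (hadd : ∀ M N, r (FDModule.directSum M N) = r M + r N) : GreenRing k H →+ ℤ :=
  let f : FreeAbelianGroup (IsoClass k H) →+ ℤ :=
    FreeAbelianGroup.lift (Quotient.lift r hr : IsoClass k H → ℤ)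
  (greenIdeal k H).ringCon.toAddCon.lift f (by
    have hle : greenRelations k H ≤ f.ker := by
      refine (AddSubgroup.closure_le _).2 ?_
      rintro _ ⟨⟨M, N⟩, rfl⟩
      have hf : ∀ M, f (FreeAbelianGroup.of (IsoClass.of M)) = r M := fun M =>
        FreeAbelianGroup.lift_apply_of _ _
      simp only [SetLike.mem_coe, AddMonoidHom.mem_ker, map_sub, hf, hadd]
      ring
    intro x y hxy
    have hxy' : f (x - y) = 0 := hle hxy
    rw [map_sub, sub_eq_zero] at hxy'
    exact hxy')

theorem liftAdd_mk (r : FDModule k H → ℤ) (hr : ∀ M N, FDModule.Isomorphic M N → r M = r N)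
    (hadd : ∀ M N, r (FDModule.directSum M N) = r M + r N) (M : FDModule k H) :
    liftAdd r hr hadd (GreenRing.mk k H M) = r M :=
  FreeAbelianGroup.lift_apply_of _ _

/-- The rank of the action of `a`, on the Green ring. -/
noncomputable def rank (a : H) : GreenRing k H →+ ℤ :=
  liftAdd (fun M => (FDModule.rankAct a M : ℤ))
    (fun _ _ h => by rw [h.rankAct_eq a])
    (fun M N => by rw [FDModule.rankAct_directSum, Nat.cast_add])

theorem rank_mk (a : H) (M : FDModule k H) :
    rank a (GreenRing.mk k H M) = (FDModule.rankAct a M : ℤ) := liftAdd_mk ..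

end GreenRing

/-! ## Modules over the Taft algebra -/

/-- A linear map commuting with a nilpotent endomorphism is injective if it is injective on the
kernel of that endomorphism. -/
theorem LinearMap.injective_of_injective_on_ker {k M V : Type*} [Field k] [AddCommGroup M]
    [Module k M] [AddCommGroup V] [Module k V] (f : M →ₗ[k] V) {a : Module.End k M}
    {b : Module.End k V} (hf : ∀ x, f (a x) = b (f x)) {N : ℕ} (ha : a ^ N = 0)
    (h : ∀ x, a x = 0 → f x = 0 → x = 0) : Function.Injective f := by
  -- If $a^{j+1}x=0$ and $f(x)=0$, then $ax$ is killed by $a^j$ and by $f$, so $ax=0$ by induction,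
  -- and the hypothesis on $\ker a$ applies to $x$.
  have key : ∀ j x, (a ^ j) x = 0 → f x = 0 → x = 0 := by
    intro j
    induction j with
    | zero => intro x hx _; simpa using hx
    | succ j ih =>
      intro x hx hfx
      refine h x (ih (a x) ?_ ?_) hfx
      · rwa [pow_succ] at hx
      · rw [hf, hfx, map_zero]
  rw [injective_iff_map_eq_zero]
  exact fun x hx => key N x (by rw [ha]; rfl) hx

namespace TaftAlgebra

open FDModule

/-! ### The cyclic modules in coordinates -/

section Cyclic

variable {k : Type u} [Field k]

/-- The standard basis vector with index `t`, which is zero if `l ≤ t`. -/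
def stdVec (k : Type u) [Field k] (l t : ℕ) : Fin l → k := fun j => if (j : ℕ) = t then 1 else 0

theorem stdVec_apply (l t : ℕ) (j : Fin l) : stdVec k l t j = if (j : ℕ) = t then 1 else 0 := rfl

theorem stdVec_of_le {l t : ℕ} (h : l ≤ t) : stdVec k l t = 0 := by
  funext j
  rw [stdVec_apply, if_neg (by omega)]
  rfl

theorem sum_smul_stdVec {l : ℕ} (x : Fin l → k) : x = ∑ j : Fin l, x j • stdVec k l j := by
  funext i
  simp [stdVec_apply, Finset.sum_apply, Fin.val_inj]

theorem hom_ext {l : ℕ} {V : Type*} [AddCommGroup V] [Module k V] {f f' : (Fin l → k) →ₗ[k] V}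
    (h : ∀ t, t < l → f (stdVec k l t) = f' (stdVec k l t)) : f = f' := by
  refine LinearMap.ext fun x => ?_
  rw [sum_smul_stdVec x, map_sum, map_sum]
  simp only [map_smul]
  exact Finset.sum_congr rfl fun j _ => by rw [h j j.2]

/-- The shift `e_t ↦ e_{t+1}`. -/
def shift (k : Type u) [Field k] (l : ℕ) : Module.End k (Fin l → k) where
  toFun x j := if (j : ℕ) = 0 then 0 else x ⟨j - 1, by omega⟩
  map_add' x y := by funext j; by_cases hj : (j : ℕ) = 0 <;> simp [hj]
  map_smul' c x := by funext j; by_cases hj : (j : ℕ) = 0 <;> simp [hj]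

theorem shift_apply (l : ℕ) (x : Fin l → k) (j : Fin l) :
    shift k l x j = if (j : ℕ) = 0 then 0 else x ⟨j - 1, by omega⟩ := rfl

theorem shift_stdVec (l t : ℕ) : shift k l (stdVec k l t) = stdVec k l (t + 1) := by
  funext j
  rw [shift_apply, stdVec_apply, stdVec_apply]
  split_ifs with h1 h2 h2 h3 h3
  · omega
  · rfl
  · rfl
  · simp only at h2; omega
  · simp only at h2; omega
  · rfl

theorem shift_pow_stdVec (l t m : ℕ) : (shift k l ^ m) (stdVec k l t) = stdVec k l (t + m) := by
  induction m with
  | zero => rfl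
  | succ m ih => rw [pow_succ', Module.End.mul_apply, ih, shift_stdVec, add_assoc]

theorem shift_pow_eq_zero {l n : ℕ} (h : l ≤ n) : shift k l ^ n = 0 :=
  hom_ext fun t _ => by rw [shift_pow_stdVec, stdVec_of_le (by omega)]; rfl

/-- Coordinate $j$ of $x$ reappears as coordinate $j+1$ of the shifted vector, so only the last one
can survive. The kernel of $h$ on a cyclic module is thus a line, on which injectivity of
homomorphisms is tested. -/
theorem eq_smul_stdVec_of_shift_eq_zero {a : ℕ} {x : Fin (a + 1) → k}
    (hx : shift k (a + 1) x = 0) : x = x (Fin.last a) • stdVec k (a + 1) a := by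
  funext j
  rw [Pi.smul_apply, stdVec_apply]
  split_ifs with hj
  · have : j = Fin.last a := Fin.ext hj
    simp [this]
  · have h := congrFun hx ⟨j + 1, by omega⟩
    rw [shift_apply, if_neg (by simp)] at h
    simpa using h

/-- The diagonal map `e_t ↦ p ^ (r + t) e_t`. -/
def diag (p : k) (l r : ℕ) : Module.End k (Fin l → k) where
  toFun x j := p ^ (r + j) * x j
  map_add' x y := by funext j; simp [mul_add]
  map_smul' c x := by funext j; simp [mul_left_comm]

theorem diag_stdVec (p : k) (l r t : ℕ) :
    diag p l r (stdVec k l t) = p ^ (r + t) • stdVec k l t := by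
  funext j
  change p ^ (r + (j : ℕ)) * stdVec k l t j = p ^ (r + t) * stdVec k l t j
  rw [stdVec_apply]
  split_ifs with h
  · rw [h]
  · simp

theorem diag_pow_stdVec (p : k) (l r t m : ℕ) :
    (diag p l r ^ m) (stdVec k l t) = (p ^ (r + t)) ^ m • stdVec k l t := by
  induction m with
  | zero => simp
  | succ m ih => rw [pow_succ', Module.End.mul_apply, ih, map_smul, diag_stdVec, smul_smul, pow_succ]

variable {n : ℕ} {q : k}

/-- The representation with `g e_t = q⁻¹ ^ (r + t) e_t` and `h e_t = e_{t+1}`. -/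
noncomputable def cycRep (hq : IsPrimitiveRoot q n) (hn : n ≠ 0) {l : ℕ} (hl : l ≤ n) (r : ℕ) :
    TaftAlgebra k n q →ₐ[k] Module.End k (Fin l → k) :=
  lift (diag q⁻¹ l r) (shift k l)
    (hom_ext fun t _ => by
      rw [diag_pow_stdVec, ← pow_mul, mul_comm, pow_mul, hq.inv.pow_eq_one, one_pow, one_smul]
      rfl)
    (shift_pow_eq_zero hl)
    (hom_ext fun t _ => by
      have hq0 : q ≠ 0 := hq.ne_zero hn
      -- Both sides send $e_t$ to a multiple of $e_{t+1}$, and $q\cdot q^{-(r+t+1)}=q^{-(r+t)}$.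
      simp only [Module.End.mul_apply, LinearMap.smul_apply, diag_stdVec, shift_stdVec, map_smul,
        smul_smul]
      rw [← add_assoc, pow_succ, mul_left_comm, mul_inv_cancel₀ hq0, mul_one])

theorem cycRep_g (hq : IsPrimitiveRoot q n) (hn : n ≠ 0) {l : ℕ} (hl : l ≤ n) (r : ℕ) :
    cycRep hq hn hl r (g k n q) = diag q⁻¹ l r := lift_g ..

theorem cycRep_h (hq : IsPrimitiveRoot q n) (hn : n ≠ 0) {l : ℕ} (hl : l ≤ n) (r : ℕ) :
    cycRep hq hn hl r (h k n q) = shift k l := lift_h ..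

/-- The cyclic module with basis `e_0, …, e_{l-1}`, with `g e_t = q⁻¹ ^ (r + t) e_t` and
`h e_t = e_{t+1}`. -/
noncomputable def cyc (hq : IsPrimitiveRoot q n) (hn : n ≠ 0) {l : ℕ} (hl : l ≤ n) (r : ℕ) :
    FDModule k (TaftAlgebra k n q) where
  carrier := Fin l → k
  ρ := cycRep hq hn hl r

end Cyclic

/-! ### Homomorphisms from cyclic modules and recognition criteria -/

section Actions

variable {k : Type u} [Field k] {n : ℕ} {q : k}

/-- The action of `g`. -/
noncomputable def gAct (V : FDModule k (TaftAlgebra k n q)) : Module.End k V.carrier :=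
  V.ρ (g k n q)

/-- The action of `h`. -/
noncomputable def hAct (V : FDModule k (TaftAlgebra k n q)) : Module.End k V.carrier :=
  V.ρ (h k n q)

theorem gAct_cyc (hq : IsPrimitiveRoot q n) (hn : n ≠ 0) {l : ℕ} (hl : l ≤ n) (r : ℕ) :
    gAct (cyc hq hn hl r) = diag q⁻¹ l r := cycRep_g hq hn hl r

theorem hAct_cyc (hq : IsPrimitiveRoot q n) (hn : n ≠ 0) {l : ℕ} (hl : l ≤ n) (r : ℕ) :
    hAct (cyc hq hn hl r) = shift k l := cycRep_h hq hn hl r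

variable (V : FDModule k (TaftAlgebra k n q))

theorem hAct_pow : hAct V ^ n = 0 := by rw [hAct, ← map_pow, h_pow, map_zero]

theorem hAct_gAct (v : V.carrier) : hAct V (gAct V v) = q • gAct V (hAct V v) := by
  have := congrArg V.ρ (h_mul_g k n q)
  rw [map_mul, map_smul, map_mul] at this
  exact LinearMap.congr_fun this v

variable {V}

/-- Since $gh=q^{-1}hg$, each application of $h$ multiplies the eigenvalue of $g$ by $q^{-1}$. -/
theorem gAct_hAct_pow (hq0 : q ≠ 0) {v : V.carrier} {r : ℕ} (hv : gAct V v = q⁻¹ ^ r • v) (t : ℕ) :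
    gAct V ((hAct V ^ t) v) = q⁻¹ ^ (r + t) • (hAct V ^ t) v := by
  induction t with
  | zero => exact hv
  | succ t ih =>
    have h1 := hAct_gAct V ((hAct V ^ t) v)
    rw [ih, map_smul] at h1
    rw [pow_succ', Module.End.mul_apply, ← add_assoc, pow_succ, mul_comm, mul_smul, h1, smul_smul,
      inv_mul_cancel₀ hq0, one_smul]

theorem map_ρ_of_map_gAct_hAct {M N : FDModule k (TaftAlgebra k n q)}
    (f : M.carrier →ₗ[k] N.carrier) (hg : ∀ v, f (gAct M v) = gAct N (f v))
    (hh : ∀ v, f (hAct M v) = hAct N (f v)) (a : TaftAlgebra k n q) (v : M.carrier) :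
    f (M.ρ a v) = N.ρ a (f v) := by
  induction a using induction generalizing v with
  | scalar c => simp
  | hg => exact hg v
  | hh => exact hh v
  | add x y hx hy => simp only [map_add, LinearMap.add_apply, hx, hy]
  | mul x y hx hy => simp only [map_mul, Module.End.mul_apply, hx, hy]

/-- A homomorphism between modules of the same dimension that is injective on the kernel of `h` is
an isomorphism. -/
theorem isomorphic_of_injective_on_ker {M N : FDModule k (TaftAlgebra k n q)}
    (f : M.carrier →ₗ[k] N.carrier) (hg : ∀ v, f (gAct M v) = gAct N (f v))
    (hh : ∀ v, f (hAct M v) = hAct N (f v)) (hker : ∀ v, hAct M v = 0 → f v = 0 → v = 0)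
    (hd : Module.finrank k M.carrier = Module.finrank k N.carrier) : Isomorphic M N :=
  ⟨LinearEquiv.ofInjectiveOfFinrankEq f
    (f.injective_of_injective_on_ker hh (hAct_pow M) hker) hd,
    map_ρ_of_map_gAct_hAct f hg hh⟩

/-- The linear map `e_t ↦ h ^ t v`. -/
noncomputable def cycHom (l : ℕ) (v : V.carrier) : (Fin l → k) →ₗ[k] V.carrier :=
  Fintype.linearCombination k fun j : Fin l => (hAct V ^ (j : ℕ)) v

theorem cycHom_stdVec {l t : ℕ} (v : V.carrier) (ht : t < l) :
    cycHom l v (stdVec k l t) = (hAct V ^ t) v := by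
  rw [cycHom, Fintype.linearCombination_apply, Finset.sum_eq_single ⟨t, ht⟩]
  · simp [stdVec_apply]
  · intro j _ hj
    rw [stdVec_apply, if_neg (fun h => hj (Fin.ext h)), zero_smul]
  · simp

theorem cycHom_gAct (hq : IsPrimitiveRoot q n) (hn : n ≠ 0) {l : ℕ} (hl : l ≤ n) {r : ℕ}
    {v : V.carrier} (hv : gAct V v = q⁻¹ ^ r • v) (x : Fin l → k) :
    cycHom l v (gAct (cyc hq hn hl r) x) = gAct V (cycHom l v x) := by
  rw [gAct_cyc]
  refine LinearMap.congr_fun (f := cycHom l v ∘ₗ diag q⁻¹ l r) (g := gAct V ∘ₗ cycHom l v)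
    (hom_ext fun t ht => ?_) x
  rw [LinearMap.comp_apply, LinearMap.comp_apply, diag_stdVec, map_smul, cycHom_stdVec v ht,
    gAct_hAct_pow (hq.ne_zero hn) hv]

/-- The condition $h^lv=0$ matters only for the last basis vector, which the shift sends to zero. -/
theorem cycHom_hAct (hq : IsPrimitiveRoot q n) (hn : n ≠ 0) {l : ℕ} (hl : l ≤ n) (r : ℕ)
    {v : V.carrier} (hv : (hAct V ^ l) v = 0) (x : Fin l → k) :
    cycHom l v (hAct (cyc hq hn hl r) x) = hAct V (cycHom l v x) := by
  rw [hAct_cyc]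
  refine LinearMap.congr_fun (f := cycHom l v ∘ₗ shift k l) (g := hAct V ∘ₗ cycHom l v)
    (hom_ext fun t ht => ?_) x
  rw [LinearMap.comp_apply, LinearMap.comp_apply, shift_stdVec, cycHom_stdVec v ht,
    ← Module.End.mul_apply, ← pow_succ']
  rcases Nat.lt_or_ge (t + 1) l with h | h
  · exact cycHom_stdVec v h
  · obtain rfl : t + 1 = l := by omega
    rw [stdVec_of_le le_rfl, map_zero, hv]

/-- Recognition of cyclic modules. -/
theorem cyc_isomorphic (hq : IsPrimitiveRoot q n) (hn : n ≠ 0) {a : ℕ} (ha : a + 1 ≤ n) {r : ℕ}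
    {v : V.carrier} (hg : gAct V v = q⁻¹ ^ r • v) (hh : (hAct V ^ (a + 1)) v = 0)
    (hv : (hAct V ^ a) v ≠ 0) (hd : Module.finrank k V.carrier = a + 1) :
    Isomorphic (cyc hq hn ha r) V := by
  refine isomorphic_of_injective_on_ker (cycHom (a + 1) v) (cycHom_gAct hq hn ha hg)
    (cycHom_hAct hq hn ha r hh) ?_ ?_
  -- The kernel of $h$ is spanned by $e_a$, whose image $h^av$ is nonzero.
  · intro (x : Fin (a + 1) → k) hx (hfx : cycHom (a + 1) v x = 0)
    rw [hAct_cyc] at hx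
    have hx' := eq_smul_stdVec_of_shift_eq_zero hx
    rw [hx', map_smul, cycHom_stdVec v (Nat.lt_succ_self a)] at hfx
    rw [(smul_eq_zero.1 hfx).resolve_right hv, zero_smul] at hx'
    exact hx'
  · rw [hd]
    exact Module.finrank_fin_fun k

/-- Recognition of sums of two cyclic modules with different socles. -/
theorem directSum_cyc_isomorphic (hq : IsPrimitiveRoot q n) (hn : n ≠ 0) {a b : ℕ}
    (ha : a + 1 ≤ n) (hb : b + 1 ≤ n) {r s : ℕ} {v w : V.carrier}
    (hgv : gAct V v = q⁻¹ ^ r • v) (hhv : (hAct V ^ (a + 1)) v = 0) (hv : (hAct V ^ a) v ≠ 0)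
    (hgw : gAct V w = q⁻¹ ^ s • w) (hhw : (hAct V ^ (b + 1)) w = 0) (hw : (hAct V ^ b) w ≠ 0)
    (hne : q⁻¹ ^ (r + a) ≠ q⁻¹ ^ (s + b))
    (hd : Module.finrank k V.carrier = (a + 1) + (b + 1)) :
    Isomorphic (directSum (cyc hq hn ha r) (cyc hq hn hb s)) V := by
  refine isomorphic_of_injective_on_ker
    (LinearMap.coprod (M := Fin (a + 1) → k) (M₂ := Fin (b + 1) → k)
      (cycHom (a + 1) v) (cycHom (b + 1) w)) ?_ ?_ ?_ ?_
  · intro (x : (Fin (a + 1) → k) × (Fin (b + 1) → k))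
    change cycHom (a + 1) v (gAct (cyc hq hn ha r) x.1) +
      cycHom (b + 1) w (gAct (cyc hq hn hb s) x.2) =
        gAct V (cycHom (a + 1) v x.1 + cycHom (b + 1) w x.2)
    rw [map_add, cycHom_gAct hq hn ha hgv, cycHom_gAct hq hn hb hgw]
  · intro (x : (Fin (a + 1) → k) × (Fin (b + 1) → k))
    change cycHom (a + 1) v (hAct (cyc hq hn ha r) x.1) +
      cycHom (b + 1) w (hAct (cyc hq hn hb s) x.2) =
        hAct V (cycHom (a + 1) v x.1 + cycHom (b + 1) w x.2)
    rw [map_add, cycHom_hAct hq hn ha r hhv, cycHom_hAct hq hn hb s hhw]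
  · rintro (⟨x, y⟩ : (Fin (a + 1) → k) × (Fin (b + 1) → k)) hx hfx
    have hx1 : hAct (cyc hq hn ha r) x = 0 := congrArg Prod.fst hx
    have hy1 : hAct (cyc hq hn hb s) y = 0 := congrArg Prod.snd hx
    rw [hAct_cyc] at hx1 hy1
    have hx' := eq_smul_stdVec_of_shift_eq_zero hx1
    have hy' := eq_smul_stdVec_of_shift_eq_zero hy1
    have hsum : cycHom (a + 1) v x + cycHom (b + 1) w y = 0 := hfx
    rw [hx', hy', map_smul, map_smul, cycHom_stdVec v (Nat.lt_succ_self a),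
      cycHom_stdVec w (Nat.lt_succ_self b)] at hsum
    -- The two socle vectors $h^av$ and $h^bw$ have different eigenvalues under $g$, so comparing
    -- the relation between them with its image under $g$ eliminates $w$.
    have hg := congrArg (gAct V) hsum
    rw [map_add, map_smul, map_smul, gAct_hAct_pow (hq.ne_zero hn) hgv,
      gAct_hAct_pow (hq.ne_zero hn) hgw, map_zero] at hg
    generalize x (Fin.last a) = c at *
    generalize y (Fin.last b) = d at *
    have h1 : (c * (q⁻¹ ^ (r + a) - q⁻¹ ^ (s + b))) • (hAct V ^ a) v = 0 := by
      linear_combination (norm := module) hg - q⁻¹ ^ (s + b) • hsum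
    have hc : c = 0 := (mul_eq_zero.1 ((smul_eq_zero.1 h1).resolve_right hv)).resolve_right
      (sub_ne_zero.2 hne)
    rw [hc, zero_smul, zero_add] at hsum
    have hd0 : d = 0 := (smul_eq_zero.1 hsum).resolve_right hw
    rw [hc, zero_smul] at hx'
    rw [hd0, zero_smul] at hy'
    exact Prod.ext hx' hy'
  · rw [hd, finrank_directSum]
    exact congrArg₂ _ (Module.finrank_fin_fun k) (Module.finrank_fin_fun k)

end Actions

end TaftAlgebra

/-! ## Weight projections, decomposition into cyclic modules and linear independence -/

namespace TaftAlgebra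

open FDModule

/-! ### Weight projections and splitting off cyclic summands -/

section Weight

variable {k : Type u} [Field k] {n : ℕ} {q : k}

/-- A multiple of the projection onto the eigenspace of `g` with eigenvalue `q⁻¹ ^ i`. -/
noncomputable def weight (k : Type u) [Field k] (n : ℕ) (q : k) (i : ℕ) : TaftAlgebra k n q :=
  ∑ t ∈ Finset.range n, (q ^ i • g k n q) ^ t

theorem smul_g_pow (hq : IsPrimitiveRoot q n) (i : ℕ) : (q ^ i • g k n q) ^ n = 1 := by
  rw [smul_pow, g_pow, ← pow_mul, mul_comm, pow_mul, hq.pow_eq_one, one_pow, one_smul]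

/-- The element is the sum of the first $n$ powers of $q^ig$, whose $n$-th power is $1$, so
multiplication by $q^ig$ fixes it. -/
theorem g_mul_weight (hq : IsPrimitiveRoot q n) (hn : n ≠ 0) (i : ℕ) :
    g k n q * weight k n q i = q⁻¹ ^ i • weight k n q i := by
  have h := mul_geom_sum (q ^ i • g k n q) n
  rw [smul_g_pow hq, sub_self, sub_mul, one_mul, sub_eq_zero] at h
  change (q ^ i • g k n q) * weight k n q i = weight k n q i at h
  conv_rhs => rw [← h]
  rw [smul_mul_assoc, smul_smul, ← mul_pow, inv_mul_cancel₀ (hq.ne_zero hn), one_pow, one_smul]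

theorem weight_mul_g (hq : IsPrimitiveRoot q n) (hn : n ≠ 0) (i : ℕ) :
    weight k n q i * g k n q = q⁻¹ ^ i • weight k n q i := by
  have h := geom_sum_mul (q ^ i • g k n q) n
  rw [smul_g_pow hq, sub_self, mul_sub, mul_one, sub_eq_zero] at h
  change weight k n q i * (q ^ i • g k n q) = weight k n q i at h
  conv_rhs => rw [← h]
  rw [mul_smul_comm, smul_smul, ← mul_pow, inv_mul_cancel₀ (hq.ne_zero hn), one_pow, one_smul]

/-- The coefficient of $g^t$ is $\sum_i q^{it}$, a geometric sum that vanishes for $0<t<n$. As $n$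
is invertible in $k$, every vector is therefore a combination of its weight components. -/
theorem sum_weight (hq : IsPrimitiveRoot q n) (hn : n ≠ 0) :
    ∑ i ∈ Finset.range n, weight k n q i = (n : k) • (1 : TaftAlgebra k n q) := by
  simp only [weight]
  rw [Finset.sum_comm, Finset.sum_eq_single 0]
  · simp [Nat.cast_smul_eq_nsmul]
  · intro t ht ht0
    have h1 : q ^ t ≠ 1 := hq.pow_ne_one_of_pos_of_lt ht0 (Finset.mem_range.1 ht)
    have h2 := geom_sum_mul (q ^ t) n
    rw [← pow_mul, mul_comm t, pow_mul, hq.pow_eq_one, one_pow, sub_self] at h2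
    have h3 := (mul_eq_zero.1 h2).resolve_right (sub_ne_zero.2 h1)
    simp only [smul_pow, ← pow_mul, mul_comm _ t]
    simp only [pow_mul]
    rw [← Finset.sum_smul, h3, zero_smul]
  · intro h
    exact absurd (Finset.mem_range.2 (Nat.pos_of_ne_zero hn)) h

/-- The scalar is the geometric sum of $n$ powers of the root of unity $q^{i-s}$, which is $n$ if
that root is $1$ and $0$ otherwise. -/
theorem ρ_weight_of_eigen [DecidableEq k] (hq : IsPrimitiveRoot q n) (hn : n ≠ 0)
    {V : FDModule k (TaftAlgebra k n q)} {v : V.carrier} {s : ℕ} (hv : gAct V v = q⁻¹ ^ s • v)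
    (i : ℕ) : V.ρ (weight k n q i) v = (if q⁻¹ ^ i = q⁻¹ ^ s then (n : k) else 0) • v := by
  have hpow : ∀ t, V.ρ ((q ^ i • g k n q) ^ t) v = (q ^ i * q⁻¹ ^ s) ^ t • v := by
    intro t
    induction t with
    | zero => simp
    | succ t ih =>
      rw [pow_succ, map_mul, Module.End.mul_apply, map_smul, LinearMap.smul_apply]
      change V.ρ _ (q ^ i • gAct V v) = _
      rw [hv, smul_smul, map_smul, ih, smul_smul, pow_succ, mul_comm]
  have hsum : V.ρ (weight k n q i) v =
      (∑ t ∈ Finset.range n, (q ^ i * q⁻¹ ^ s) ^ t) • v := by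
    rw [weight, map_sum, LinearMap.sum_apply, Finset.sum_smul]
    exact Finset.sum_congr rfl fun t _ => hpow t
  have hq0 := pow_ne_zero i (hq.ne_zero hn)
  rw [hsum]
  congr 1
  split_ifs with h
  · rw [← h, inv_pow, mul_inv_cancel₀ hq0]
    simp
  · have hne : q ^ i * q⁻¹ ^ s ≠ 1 := fun h1 => h (by
      rw [inv_pow q i]
      exact inv_eq_of_mul_eq_one_right h1)
    have h2 := mul_geom_sum (q ^ i * q⁻¹ ^ s) n
    rw [mul_pow, ← pow_mul, ← pow_mul, mul_comm i, mul_comm s, pow_mul, pow_mul, hq.pow_eq_one,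
      hq.inv.pow_eq_one, one_pow, one_pow, mul_one, sub_self] at h2
    exact (mul_eq_zero.1 h2).resolve_left (sub_ne_zero.2 hne)

theorem hAct_pow_gAct (V : FDModule k (TaftAlgebra k n q)) (m : ℕ) (v : V.carrier) :
    (hAct V ^ m) (gAct V v) = q ^ m • gAct V ((hAct V ^ m) v) := by
  induction m with
  | zero => simp
  | succ m ih =>
    rw [pow_succ', Module.End.mul_apply, ih, map_smul, hAct_gAct, smul_smul, ← pow_succ]
    rfl

/-- Any $n$ consecutive weights are distinct, so a cyclic module has one-dimensional weight spaces.
-/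
theorem pow_inv_ne (hq : IsPrimitiveRoot q n) (hn : n ≠ 0) {s a : ℕ} (r : ℕ) (hs : s < n)
    (ha : a < n) (hsa : s ≠ a) : q⁻¹ ^ (r + s) ≠ q⁻¹ ^ (r + a) := by
  rw [pow_add, pow_add]
  intro h
  exact hsa (hq.inv.pow_inj hs ha
    (mul_left_cancel₀ (pow_ne_zero r (inv_ne_zero (hq.ne_zero hn))) h))

/-- The linear map `w ↦ ∑ ξ (h ^ (a - j) w) e_j`. -/
noncomputable def coCycHom {V : FDModule k (TaftAlgebra k n q)} (a : ℕ)
    (ξ : V.carrier →ₗ[k] k) : V.carrier →ₗ[k] (Fin (a + 1) → k) :=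
  LinearMap.pi fun j => ξ ∘ₗ (hAct V ^ (a - j))

theorem coCycHom_apply {V : FDModule k (TaftAlgebra k n q)} (a : ℕ) (ξ : V.carrier →ₗ[k] k)
    (w : V.carrier) (j : Fin (a + 1)) : coCycHom a ξ w j = ξ ((hAct V ^ (a - j)) w) := rfl

/-- A cyclic submodule of maximal length is a direct summand. -/
theorem exists_cyc_directSum_isomorphic (hq : IsPrimitiveRoot q n) (hn : n ≠ 0)
    (hnk : (n : k) ≠ 0) {V : FDModule k (TaftAlgebra k n q)} {a r : ℕ} (ha : a + 1 ≤ n)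
    (hh : hAct V ^ (a + 1) = 0) {v : V.carrier} (hg : gAct V v = q⁻¹ ^ r • v)
    (hv : (hAct V ^ a) v ≠ 0) :
    ∃ K, Isomorphic (directSum (cyc hq hn ha r) K) V := by
  classical
  have hq0 := hq.ne_zero hn
  obtain ⟨f, hf⟩ : ∃ f : Module.Dual k V.carrier, f ((hAct V ^ a) v) ≠ 0 := by
    by_contra! h
    exact hv ((Module.forall_dual_apply_eq_zero_iff k _).1 h)
  -- Projecting to weight $r+a$ before applying $f$ makes $\xi$ an eigenfunctional of $g$ that kills
  -- $h^sv$ for $s<a$; the scalar normalises $\xi(h^av)=1$.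
  let ξ : V.carrier →ₗ[k] k :=
    ((n : k) * f ((hAct V ^ a) v))⁻¹ • f ∘ₗ V.ρ (weight k n q (r + a))
  have hξg : ∀ w, ξ (gAct V w) = q⁻¹ ^ (r + a) * ξ w := by
    intro w
    have h1 : V.ρ (weight k n q (r + a)) (gAct V w) =
        q⁻¹ ^ (r + a) • V.ρ (weight k n q (r + a)) w := by
      have := congrArg V.ρ (weight_mul_g hq hn (r + a))
      rw [map_mul, map_smul] at this
      exact LinearMap.congr_fun this w
    simp only [ξ, LinearMap.smul_apply, LinearMap.comp_apply, h1, smul_eq_mul]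
    rw [map_smul, smul_eq_mul]
    ring
  have hξv : ∀ s, ξ ((hAct V ^ s) v) = if s = a then 1 else 0 := by
    intro s
    rcases Nat.lt_or_ge a s with hs | hs
    · obtain ⟨m, rfl⟩ : ∃ m, s = m + (a + 1) := ⟨s - (a + 1), by omega⟩
      rw [pow_add, hh, mul_zero, LinearMap.zero_apply, map_zero, if_neg (by omega)]
    · have h1 := ρ_weight_of_eigen hq hn (gAct_hAct_pow hq0 hg s) (r + a)
      simp only [ξ, LinearMap.smul_apply, LinearMap.comp_apply, h1, map_smul, smul_eq_mul]
      by_cases hsa : s = a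
      · subst hsa
        rw [if_pos rfl, if_pos rfl]
        exact inv_mul_cancel₀ (mul_ne_zero hnk hf)
      · rw [if_neg (pow_inv_ne hq hn r (by omega) (by omega) (Ne.symm hsa)), if_neg hsa]
        simp
  -- Moving $g$ past $h^{a-j}$ costs $q^{a-j}$, which turns the eigenvalue $q^{-(r+a)}$ of $\xi$
  -- into $q^{-(r+j)}$.
  have hβg : ∀ w, coCycHom a ξ (gAct V w) = gAct (cyc hq hn ha r) (coCycHom a ξ w) := by
    intro w
    rw [gAct_cyc]
    funext j
    change ξ ((hAct V ^ (a - j)) (gAct V w)) = q⁻¹ ^ (r + j) * ξ ((hAct V ^ (a - j)) w)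
    rw [hAct_pow_gAct, map_smul, hξg, smul_eq_mul, ← mul_assoc]
    congr 1
    have hj : r + a = (a - j) + (r + j) := by have := j.2; omega
    rw [hj, pow_add, ← mul_assoc, ← mul_pow, mul_inv_cancel₀ hq0, one_pow, one_mul]
  have hβh : ∀ w, coCycHom a ξ (hAct V w) = hAct (cyc hq hn ha r) (coCycHom a ξ w) := by
    intro w
    rw [hAct_cyc]
    funext j
    change ξ ((hAct V ^ (a - j)) (hAct V w)) = shift k (a + 1) (coCycHom a ξ w) j
    rw [shift_apply]
    rw [← Module.End.mul_apply, ← pow_succ]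
    split_ifs with hj
    -- Coordinate $0$ is $\xi(h^{a+1}w)$, and this is where the maximality of the length is needed.
    · rw [hj, Nat.sub_zero, hh, LinearMap.zero_apply, map_zero]
    · rw [coCycHom_apply]
      congr 3
      have := j.2
      simp only
      omega
  refine exists_isomorphic_directSum_of_retract (M := cyc hq hn ha r)
    (cycHom (a + 1) v) (coCycHom a ξ)
    (map_ρ_of_map_gAct_hAct (M := cyc hq hn ha r) _ (cycHom_gAct hq hn ha hg)
      (cycHom_hAct hq hn ha r (by rw [hh]; rfl)))
    (map_ρ_of_map_gAct_hAct (N := cyc hq hn ha r) _ hβg hβh) ?_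
  · intro (x : Fin (a + 1) → k)
    refine LinearMap.congr_fun (f := coCycHom a ξ ∘ₗ cycHom (a + 1) v) (g := LinearMap.id)
      (hom_ext fun t ht => ?_) x
    rw [LinearMap.comp_apply, cycHom_stdVec v ht]
    funext j
    rw [coCycHom_apply, ← Module.End.mul_apply, ← pow_add, hξv, LinearMap.id_apply, stdVec_apply]
    have := j.2
    split_ifs <;> first | rfl | omega

/-- The length is the nilpotency index of $h$ on $V$, the largest that a cyclic submodule can have.
-/
theorem exists_summand (hq : IsPrimitiveRoot q n) (hn : n ≠ 0) (hnk : (n : k) ≠ 0)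
    (V : FDModule k (TaftAlgebra k n q)) [Nontrivial V.carrier] :
    ∃ (a r : Fin n) (K : FDModule k (TaftAlgebra k n q)),
      Isomorphic (directSum (cyc hq hn (l := a + 1) a.2 r) K) V := by
  classical
  have hex : ∃ l, hAct V ^ l = 0 := ⟨n, hAct_pow V⟩
  have hpos : Nat.find hex ≠ 0 := by
    intro h0
    have := Nat.find_spec hex
    rw [h0, pow_zero] at this
    exact one_ne_zero this
  obtain ⟨a, ha⟩ := Nat.exists_eq_succ_of_ne_zero hpos
  have hh : hAct V ^ (a + 1) = 0 := by
    have := Nat.find_spec hex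
    rwa [ha] at this
  have han : a + 1 ≤ n := ha.symm.trans_le (Nat.find_min' hex (hAct_pow V))
  have hmin : hAct V ^ a ≠ 0 := Nat.find_min hex (by omega)
  obtain ⟨x, hx⟩ : ∃ x, (hAct V ^ a) x ≠ 0 := by
    by_contra! h
    exact hmin (LinearMap.ext h)
  -- If $h^a$ killed every weight component of $x$, it would kill their sum $nx$.
  obtain ⟨r, hr, hrx⟩ : ∃ r ∈ Finset.range n, (hAct V ^ a) (V.ρ (weight k n q r) x) ≠ 0 := by
    by_contra! h
    have h1 : (hAct V ^ a) (V.ρ (∑ i ∈ Finset.range n, weight k n q i) x) = 0 := by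
      rw [map_sum, LinearMap.sum_apply, map_sum]
      exact Finset.sum_eq_zero h
    rw [sum_weight hq hn, map_smul, map_one, LinearMap.smul_apply, map_smul] at h1
    exact hx ((smul_eq_zero.1 h1).resolve_left hnk)
  have hg : gAct V (V.ρ (weight k n q r) x) = q⁻¹ ^ r • V.ρ (weight k n q r) x := by
    have := congrArg V.ρ (g_mul_weight hq hn r)
    rw [map_mul, map_smul] at this
    exact LinearMap.congr_fun this x
  obtain ⟨K, hK⟩ := exists_cyc_directSum_isomorphic hq hn hnk han hh hg hrx
  exact ⟨⟨a, han⟩, ⟨r, Finset.mem_range.1 hr⟩, K, hK⟩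

/-- If the characteristic $p$ divided $n=pm$, then $(q^m)^p=1$ would force $q^m=1$. -/
theorem natCast_ne_zero (hq : IsPrimitiveRoot q n) (hn : n ≠ 0) : (n : k) ≠ 0 := by
  have : NeZero n := ⟨hn⟩
  exact hq.neZero'.out

/-- The only basis vector that can survive the weight projection is $e_{t_0}$, where $t_0$ is the
residue of $i-r$; then $h^j$ moves it to $e_{t_0+j}$, which is zero from index $l$ on. -/
theorem rankAct_cyc (hq : IsPrimitiveRoot q n) (hn : n ≠ 0) {l : ℕ} (hl : l ≤ n) {r i t₀ : ℕ}
    (ht₀ : t₀ < n) (hi : q⁻¹ ^ i = q⁻¹ ^ (r + t₀)) (j : ℕ) :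
    rankAct (h k n q ^ j * weight k n q i) (cyc hq hn hl r) = if t₀ + j < l then 1 else 0 := by
  classical
  let T : Module.End k (Fin l → k) := cycRep hq hn hl r (h k n q ^ j * weight k n q i)
  have hT : T = shift k l ^ j * cycRep hq hn hl r (weight k n q i) := by
    simp only [T, map_mul, map_pow, cycRep_h]
  have hact : ∀ t, T (stdVec k l t) =
      (if q⁻¹ ^ i = q⁻¹ ^ (r + t) then (n : k) else 0) • stdVec k l (t + j) := by
    intro t
    have hg : gAct (cyc hq hn hl r) (stdVec k l t) = q⁻¹ ^ (r + t) • stdVec k l t := by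
      rw [gAct_cyc]; exact diag_stdVec ..
    have hw : cycRep hq hn hl r (weight k n q i) (stdVec k l t) =
        (if q⁻¹ ^ i = q⁻¹ ^ (r + t) then (n : k) else 0) • stdVec k l t :=
      ρ_weight_of_eigen hq hn hg i
    rw [hT, Module.End.mul_apply, hw, map_smul, shift_pow_stdVec]
  have hval : ∀ t, t < l →
      T (stdVec k l t) = (if t = t₀ then (n : k) else 0) • stdVec k l (t₀ + j) := by
    intro t ht
    rw [hact, hi]
    by_cases htt : t = t₀
    · rw [htt, if_pos rfl, if_pos rfl]
    · rw [if_neg (pow_inv_ne hq hn r ht₀ (by omega) (Ne.symm htt)), if_neg htt, zero_smul,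
        zero_smul]
  change Module.finrank k (LinearMap.range T) = _
  split_ifs with hlt
  · have hne : stdVec k l (t₀ + j) ≠ 0 := by
      intro h0
      have := congrFun h0 ⟨t₀ + j, hlt⟩
      simp [stdVec_apply] at this
    have hrange : LinearMap.range T = Submodule.span k {stdVec k l (t₀ + j)} := by
      apply le_antisymm
      · rintro _ ⟨x, rfl⟩
        rw [sum_smul_stdVec x, map_sum]
        refine Submodule.sum_mem _ fun t _ => ?_
        rw [map_smul, hval t t.2]
        exact Submodule.smul_mem _ _ (Submodule.smul_mem _ _ (Submodule.mem_span_singleton_self _))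
      · rw [Submodule.span_singleton_le_iff_mem]
        refine ⟨(n : k)⁻¹ • stdVec k l t₀, ?_⟩
        rw [map_smul, hval t₀ (by omega), if_pos rfl, smul_smul,
          inv_mul_cancel₀ (natCast_ne_zero hq hn), one_smul]
    rw [hrange]
    exact finrank_span_singleton hne
  · have hzero : T = 0 := hom_ext fun t ht => by
      rw [hval t ht, stdVec_of_le (by omega), smul_zero]
      rfl
    rw [hzero, LinearMap.range_zero]
    exact finrank_bot k _

end Weight

/-! ### The cyclic classes as an additive basis -/

section GreenRing

variable {k : Type u} [Field k] {n : ℕ} [NeZero n] {q : k} [hq : Fact (IsPrimitiveRoot q n)]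

/-- The class of the cyclic module of length `l` whose generator has weight `r`. -/
noncomputable def cycClass (q : k) [hq : Fact (IsPrimitiveRoot q n)] {l : ℕ} (hl : l ≤ n) (r : ℕ) :
    GreenRing k (TaftAlgebra k n q) :=
  GreenRing.mk k _ (cyc hq.out (NeZero.ne n) hl r)

/-- Induction on the dimension: a cyclic summand splits off a nonzero module, and the complement is
smaller. -/
theorem mk_mem_span (V : FDModule k (TaftAlgebra k n q)) :
    GreenRing.mk k _ V ∈ Submodule.span ℤ
      (Set.range fun x : Fin n × Fin n => cycClass q (l := x.1 + 1) x.1.2 x.2) := by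
  induction hd : Module.finrank k V.carrier using Nat.strong_induction_on generalizing V with
  | _ d ih =>
    rcases subsingleton_or_nontrivial V.carrier with hs | hs
    · rw [GreenRing.mk_eq_zero_of_subsingleton]
      exact Submodule.zero_mem _
    · obtain ⟨a, r, K, hK⟩ := exists_summand hq.out (NeZero.ne n)
        (natCast_ne_zero hq.out (NeZero.ne n)) V
      rw [← GreenRing.mk_eq_of_isomorphic hK, GreenRing.mk_directSum]
      refine Submodule.add_mem _ (Submodule.subset_span ⟨(a, r), rfl⟩) (ih _ ?_ K rfl)
      have h1 := hK.finrank_eq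
      have h2 : Module.finrank k (cyc hq.out (NeZero.ne n) (l := a + 1) a.2 r).carrier = a + 1 :=
        Module.finrank_fin_fun k
      rw [finrank_directSum, h2, hd] at h1
      omega

theorem span_cycClass : Submodule.span ℤ
    (Set.range fun x : Fin n × Fin n => cycClass q (l := x.1 + 1) x.1.2 x.2) = ⊤ := by
  rw [eq_top_iff]
  intro x _
  induction x using GreenRing.induction with
  | mk M => exact mk_mem_span M
  | zero => exact Submodule.zero_mem _
  | add x y hx hy => exact Submodule.add_mem _ (hx trivial) (hy trivial)
  | neg x hx => exact Submodule.neg_mem _ (hx trivial)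

variable (n) in
/-- The number of cyclic summands of length more than `j` and weight `i`. -/
noncomputable def countGT (q : k) [hq : Fact (IsPrimitiveRoot q n)] (j i : ℕ) :
    GreenRing k (TaftAlgebra k n q) →+ ℤ :=
  GreenRing.rank (h k n q ^ j * weight k n q i) -
    GreenRing.rank (h k n q ^ (j + 1) * weight k n q (i + n - 1))

/-- The rank of $h^j$ on weight $i$ counts a summand if its basis vectors of weights $i$ and $i+j$
both occur along one chain. Subtracting the chains that start one step earlier, at weight $i-1$,
leaves those whose generator has weight $i$. The index $i+n-1$ is $i-1$ modulo $n$ without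
truncation at $i=0$. -/
theorem countGT_cycClass (j : ℕ) {l : ℕ} (hl : l ≤ n) {i r : ℕ} (hi : i < n) (hr : r < n) :
    countGT n q j i (cycClass q hl r) = if i = r ∧ j < l then 1 else 0 := by
  have hpos : 0 < n := NeZero.pos n
  have hp : q⁻¹ ^ n = 1 := hq.out.inv.pow_eq_one
  have hsucc : ∀ m, q⁻¹ ^ (m + n) = q⁻¹ ^ m := fun m => by rw [pow_add, hp, mul_one]
  rw [countGT, AddMonoidHom.sub_apply, cycClass, GreenRing.rank_mk, GreenRing.rank_mk]
  by_cases hir : i = r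
  · subst hir
    rw [rankAct_cyc hq.out (NeZero.ne n) hl (t₀ := 0) hpos (by rw [add_zero]),
      rankAct_cyc hq.out (NeZero.ne n) hl (t₀ := n - 1) (by omega) (by congr 1; omega)]
    -- A chain from weight $r-1$ would start at position $n-1$, and $n+j\ge l$.
    rw [if_neg (by omega : ¬ n - 1 + (j + 1) < l)]
    simp
  -- For $i\ne r$, $t$ is the residue of $i-r-1$. It does not wrap around, so both ranks test the
  -- same inequality and cancel.
  · obtain ⟨t, ht, h1, h2⟩ : ∃ t, t + 1 < n ∧ q⁻¹ ^ i = q⁻¹ ^ (r + (t + 1)) ∧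
        q⁻¹ ^ (i + n - 1) = q⁻¹ ^ (r + t) := by
      rcases Nat.lt_or_ge r i with h | h
      · refine ⟨i - r - 1, by omega, by congr 1; omega, ?_⟩
        rw [← hsucc (r + _)]
        congr 1
        omega
      · refine ⟨i + n - r - 1, by omega, ?_, by congr 1; omega⟩
        rw [← hsucc]
        congr 1
        omega
    rw [rankAct_cyc hq.out (NeZero.ne n) hl ht h1,
      rankAct_cyc hq.out (NeZero.ne n) hl (by omega) h2,
      show t + 1 + j = t + (j + 1) by omega, sub_self, if_neg (fun h => hir h.1)]

/-- The functional that counts lengths above $a$ minus lengths above $a+1$, at weight $r$, is dual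
to the class of length $a+1$ and weight $r$. -/
theorem linearIndependent_cycClass : LinearIndependent ℤ
    (fun x : Fin n × Fin n => cycClass q (l := x.1 + 1) x.1.2 x.2) := by
  rw [Fintype.linearIndependent_iff]
  intro c hc ⟨a, r⟩
  have h1 := congrArg (countGT n q (a : ℕ) r - countGT n q ((a : ℕ) + 1) r) hc
  rw [map_sum, map_zero, Finset.sum_eq_single (a, r)] at h1
  · rw [map_zsmul, AddMonoidHom.sub_apply, countGT_cycClass _ _ r.2 r.2,
      countGT_cycClass _ _ r.2 r.2] at h1
    simpa using h1
  · rintro ⟨b, s⟩ _ hne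
    rw [map_zsmul, AddMonoidHom.sub_apply, countGT_cycClass _ _ r.2 s.2,
      countGT_cycClass _ _ r.2 s.2]
    have hne' : ¬ ((b : ℕ) = a ∧ (s : ℕ) = r) := fun h =>
      hne (Prod.ext (Fin.ext h.1) (Fin.ext h.2))
    simp only
    split_ifs <;> first | (exfalso; omega) | simp
  · simp

end GreenRing

end TaftAlgebra

/-! ## Tensor products of cyclic modules -/

namespace TaftAlgebra

open FDModule

section Tensor

variable {k : Type u} [Field k] {n : ℕ} [NeZero n] {q : k} [hq : Fact (IsPrimitiveRoot q n)]

theorem gAct_tensor (M N : FDModule k (TaftAlgebra k n q)) (x : M.carrier) (y : N.carrier) :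
    gAct (tensor M N) (x ⊗ₜ[k] y) = gAct M x ⊗ₜ[k] gAct N y := by
  change outerAction M.ρ N.ρ (Coalgebra.comul (g k n q)) (x ⊗ₜ[k] y) = _
  rw [comul_g, outerAction_tmul]
  rfl

theorem hAct_tensor (M N : FDModule k (TaftAlgebra k n q)) (x : M.carrier) (y : N.carrier) :
    hAct (tensor M N) (x ⊗ₜ[k] y) = x ⊗ₜ[k] hAct N y + hAct M x ⊗ₜ[k] gAct N y := by
  change outerAction M.ρ N.ρ (Coalgebra.comul (h k n q)) (x ⊗ₜ[k] y) = _
  rw [comul_h, map_add, LinearMap.add_apply, outerAction_tmul, outerAction_tmul, map_one]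
  rfl

/-- The basis vectors `e_i ⊗ e_j` of a tensor product of cyclic modules. -/
noncomputable def basisTmul (k : Type u) [Field k] (l m i j : ℕ) :
    (Fin l → k) ⊗[k] (Fin m → k) :=
  stdVec k l i ⊗ₜ[k] stdVec k m j

theorem basisTmul_of_le_left {l m i j : ℕ} (h : l ≤ i) : basisTmul k l m i j = 0 := by
  rw [basisTmul, stdVec_of_le h, TensorProduct.zero_tmul]

theorem basisTmul_of_le_right {l m i j : ℕ} (h : m ≤ j) : basisTmul k l m i j = 0 := by
  rw [basisTmul, stdVec_of_le h, TensorProduct.tmul_zero]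

/-- The coordinate of `e_i ⊗ e_j`. -/
noncomputable def coordTmul {l m : ℕ} (i : Fin l) (j : Fin m) :
    (Fin l → k) ⊗[k] (Fin m → k) →ₗ[k] k :=
  LinearMap.mul' k k ∘ₗ TensorProduct.map (LinearMap.proj i) (LinearMap.proj j)

theorem coordTmul_basisTmul {l m : ℕ} (i : Fin l) (j : Fin m) (s t : ℕ) :
    coordTmul i j (basisTmul k l m s t) = if (i : ℕ) = s ∧ (j : ℕ) = t then 1 else 0 := by
  simp only [coordTmul, basisTmul, LinearMap.comp_apply, TensorProduct.map_tmul,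
    LinearMap.proj_apply, LinearMap.mul'_apply, stdVec_apply, ← ite_and, mul_ite, mul_one,
    mul_zero]
  simp only [and_comm]

/-- The tensor product of two cyclic modules. -/
noncomputable abbrev cycTensor (q : k) [hq : Fact (IsPrimitiveRoot q n)] {l m : ℕ} (hl : l ≤ n)
    (hm : m ≤ n) (r s : ℕ) : FDModule k (TaftAlgebra k n q) :=
  tensor (cyc hq.out (NeZero.ne n) hl r) (cyc hq.out (NeZero.ne n) hm s)

/-- The action of `g` on a tensor product of two cyclic modules. -/
noncomputable def gTensor (q : k) [hq : Fact (IsPrimitiveRoot q n)] {l m : ℕ} (hl : l ≤ n)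
    (hm : m ≤ n) (r s : ℕ) : Module.End k ((Fin l → k) ⊗[k] (Fin m → k)) :=
  gAct (cycTensor q hl hm r s)

/-- The action of `h` on a tensor product of two cyclic modules. -/
noncomputable def hTensor (q : k) [hq : Fact (IsPrimitiveRoot q n)] {l m : ℕ} (hl : l ≤ n)
    (hm : m ≤ n) (r s : ℕ) : Module.End k ((Fin l → k) ⊗[k] (Fin m → k)) :=
  hAct (cycTensor q hl hm r s)

variable {l m : ℕ} (hl : l ≤ n) (hm : m ≤ n) (r s : ℕ)

theorem gTensor_basisTmul (i j : ℕ) :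
    gTensor q hl hm r s (basisTmul k l m i j) =
      q⁻¹ ^ (r + i + (s + j)) • basisTmul k l m i j := by
  refine (gAct_tensor (cyc hq.out (NeZero.ne n) hl r) (cyc hq.out (NeZero.ne n) hm s)
    (stdVec k l i) (stdVec k m j)).trans ?_
  rw [gAct_cyc, gAct_cyc]
  change diag q⁻¹ l r (stdVec k l i) ⊗ₜ[k] diag q⁻¹ m s (stdVec k m j) = _
  rw [diag_stdVec, diag_stdVec, TensorProduct.smul_tmul_smul, ← pow_add]
  rfl

theorem hTensor_basisTmul (i j : ℕ) :
    hTensor q hl hm r s (basisTmul k l m i j) =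
      basisTmul k l m i (j + 1) + q⁻¹ ^ (s + j) • basisTmul k l m (i + 1) j := by
  refine (hAct_tensor (cyc hq.out (NeZero.ne n) hl r) (cyc hq.out (NeZero.ne n) hm s)
    (stdVec k l i) (stdVec k m j)).trans ?_
  rw [gAct_cyc, hAct_cyc, hAct_cyc]
  change stdVec k l i ⊗ₜ[k] shift k m (stdVec k m j) +
    shift k l (stdVec k l i) ⊗ₜ[k] diag q⁻¹ m s (stdVec k m j) = _
  rw [diag_stdVec, shift_stdVec, shift_stdVec, TensorProduct.tmul_smul]
  rfl

/-- On the last basis vector of the left factor the term $h\otimes g$ vanishes, so only $1\otimes h$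
acts. -/
theorem hTensor_pow_of_last (t j : ℕ) {i : ℕ} (hi : l = i + 1) :
    (hTensor q hl hm r s ^ t) (basisTmul k l m i j) = basisTmul k l m i (j + t) := by
  induction t with
  | zero => rfl
  | succ t ih =>
    rw [pow_succ', Module.End.mul_apply, ih, hTensor_basisTmul,
      basisTmul_of_le_left (i := i + 1) (by omega), smul_zero, add_zero, add_assoc]

theorem finrank_cycTensor : Module.finrank k (cycTensor q hl hm r s).carrier = l * m := by
  refine (Module.finrank_tensorProduct (R := k) (S := k) (M := Fin l → k) (M' := Fin m → k)).trans ?_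
  rw [Module.finrank_fin_fun, Module.finrank_fin_fun]

end Tensor

/-- Multiplied by $1-q^{-1}$ the sum becomes $1-q^{-t}$, which is nonzero for $0<t<n$. -/
theorem geom_sum_inv_ne_zero {k : Type*} [Field k] {q : k} {n : ℕ} (hq : IsPrimitiveRoot q n) {t : ℕ} (h0 : t ≠ 0) (ht : t < n) :
    ∑ i ∈ Finset.range t, q⁻¹ ^ i ≠ 0 := by
  intro h
  have h1 := mul_neg_geom_sum q⁻¹ t
  rw [h, mul_zero] at h1
  exact hq.inv.pow_ne_one_of_pos_of_lt h0 ht (sub_eq_zero.1 h1.symm).symm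

/-! ### Multiplication rules for the cyclic classes -/

section Products

variable {k : Type u} [Field k] {n : ℕ} [NeZero n] {q : k} [hq : Fact (IsPrimitiveRoot q n)]

theorem cycClass_one_of_pow_eq_one (h1 : 1 ≤ n) {r : ℕ} (hr : q⁻¹ ^ r = 1) :
    cycClass q h1 r = 1 := by
  rw [← GreenRing.mk_trivial]
  refine GreenRing.mk_eq_of_isomorphic (cyc_isomorphic hq.out (NeZero.ne n) (a := 0) h1
    (V := FDModule.trivial k (TaftAlgebra k n q)) (v := (1 : k)) ?_ ?_ ?_ ?_)
  · change Coalgebra.counit (R := k) (g k n q) * (1 : k) = q⁻¹ ^ r * 1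
    rw [counit_g, hr]
  · change Coalgebra.counit (R := k) (h k n q) * (1 : k) = 0
    rw [counit_h, zero_mul]
  · exact one_ne_zero (α := k)
  · exact Module.finrank_self k

theorem cycClass_one_mul (h1 : 1 ≤ n) {a : ℕ} (ha : a + 1 ≤ n) (r s : ℕ) :
    cycClass q h1 r * cycClass q ha s = cycClass q ha (r + s) := by
  have hpow := fun t => hTensor_pow_of_last (q := q) h1 ha r s t 0 (i := 0) rfl
  rw [cycClass, cycClass, cycClass, ← GreenRing.mk_tensor]
  refine (GreenRing.mk_eq_of_isomorphic (cyc_isomorphic hq.out (NeZero.ne n) ha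
    (V := cycTensor q h1 ha r s) (v := basisTmul k 1 (a + 1) 0 0) ?_ ?_ ?_ ?_)).symm
  · exact gTensor_basisTmul ..
  · exact (hpow (a + 1)).trans (basisTmul_of_le_right (by omega))
  · intro h0
    have h0' := (hpow a).symm.trans h0
    have := (congrArg (coordTmul 0 (Fin.last a)) h0').trans (map_zero _)
    rw [coordTmul_basisTmul] at this
    simp at this
  · rw [finrank_cycTensor, one_mul]

/-- Here each application of $h$ picks up $q^{-s}$ from the right factor, a nonzero scalar. Together
with `cycClass_one_mul` this makes $y$ and $z$ commute. -/
theorem cycClass_mul_one (h1 : 1 ≤ n) {a : ℕ} (ha : a + 1 ≤ n) (r s : ℕ) :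
    cycClass q ha r * cycClass q h1 s = cycClass q ha (r + s) := by
  have hpow : ∀ t, (hTensor q ha h1 r s ^ t) (basisTmul k (a + 1) 1 0 0) =
      (q⁻¹ ^ s) ^ t • basisTmul k (a + 1) 1 t 0 := by
    intro t
    induction t with
    | zero => simp
    | succ t ih =>
      rw [pow_succ', Module.End.mul_apply, ih, map_smul, hTensor_basisTmul,
        basisTmul_of_le_right (j := 0 + 1) le_rfl, zero_add, smul_smul, add_zero,
        ← pow_succ]
  rw [cycClass, cycClass, cycClass, ← GreenRing.mk_tensor]
  refine (GreenRing.mk_eq_of_isomorphic (cyc_isomorphic hq.out (NeZero.ne n) ha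
    (V := cycTensor q ha h1 r s) (v := basisTmul k (a + 1) 1 0 0) ?_ ?_ ?_ ?_)).symm
  · exact gTensor_basisTmul ..
  · refine (hpow (a + 1)).trans ?_
    rw [basisTmul_of_le_left le_rfl, smul_zero]
    rfl
  · intro h0
    have h0' := (hpow a).symm.trans h0
    have := (congrArg (coordTmul (Fin.last a) 0) h0').trans (map_zero _)
    rw [map_smul, coordTmul_basisTmul] at this
    simp [hq.out.ne_zero (NeZero.ne n)] at this
  · rw [finrank_cycTensor, mul_one]

/-- The left factor can move from $e_0$ to $e_1$ only once; doing so when the right factor stands at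
$e_{j+i}$ contributes $q^{-(j+i)}$. For $t=0$ the truncated index $j-1$ is harmless because the sum
is empty. -/
theorem hTensor_two_pow (h2 : 2 ≤ n) {m : ℕ} (hm : m ≤ n) (j t : ℕ) :
    (hTensor q h2 hm 0 0 ^ t) (basisTmul k 2 m 0 j) = basisTmul k 2 m 0 (j + t) +
      (∑ i ∈ Finset.range t, q⁻¹ ^ (j + i)) • basisTmul k 2 m 1 (j + t - 1) := by
  induction t with
  | zero => simp
  | succ t ih =>
    rw [pow_succ', Module.End.mul_apply, ih, map_add, map_smul, hTensor_basisTmul,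
      hTensor_basisTmul, basisTmul_of_le_left (i := 1 + 1) le_rfl, smul_zero, add_zero,
      Finset.sum_range_succ, add_smul, zero_add, zero_add]
    cases t with
    | zero => simp
    | succ t =>
      rw [show j + (t + 1) - 1 + 1 = j + (t + 1) by omega,
        show j + (t + 1 + 1) - 1 = j + (t + 1) by omega,
        show j + (t + 1) + 1 = j + (t + 1 + 1) by omega]
      abel

/-- The vector $e_0\otimes e_0$ generates the long summand: $h^{b+2}$ sends it to a multiple of
$e_1\otimes e_{b+1}$ whose coefficient is a geometric sum of $b+2<n$ terms, hence nonzero. -/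
theorem cycClass_two_mul (h2 : 2 ≤ n) {b : ℕ} (hb : b + 3 ≤ n) :
    cycClass q h2 0 * cycClass q (by omega : b + 2 ≤ n) 0 =
      cycClass q hb 0 + cycClass q (by omega : b + 1 ≤ n) 1 := by
  have hb2 : b + 2 ≤ n := by omega
  have hb1 : b + 1 ≤ n := by omega
  rw [cycClass, cycClass, cycClass, cycClass, ← GreenRing.mk_tensor, ← GreenRing.mk_directSum]
  let S : k := ∑ i ∈ Finset.range (b + 2), q⁻¹ ^ i
  let v := basisTmul k 2 (b + 2) 0 0
  -- The coefficient $1-S$ is chosen so that the $e_1\otimes e_{b+1}$ term of $h^{b+1}w$ cancels;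
  -- the other term, $e_0\otimes e_{b+2}$, is zero by length.
  let w := basisTmul k 2 (b + 2) 0 1 + (1 - S) • basisTmul k 2 (b + 2) 1 0
  have hv : ∀ t, (hTensor q h2 hb2 0 0 ^ t) v = basisTmul k 2 (b + 2) 0 t +
      (∑ i ∈ Finset.range t, q⁻¹ ^ i) • basisTmul k 2 (b + 2) 1 (t - 1) := by
    intro t
    simpa using hTensor_two_pow (q := q) h2 hb2 0 t
  have hw : ∀ t, (hTensor q h2 hb2 0 0 ^ t) w = basisTmul k 2 (b + 2) 0 (1 + t) +
      (∑ i ∈ Finset.range (t + 1), q⁻¹ ^ i - S) • basisTmul k 2 (b + 2) 1 t := by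
    intro t
    rw [map_add, map_smul, hTensor_two_pow, hTensor_pow_of_last _ _ _ _ _ _ rfl,
      Finset.sum_range_succ', add_assoc, Nat.add_sub_cancel_left, zero_add, ← add_smul]
    simp only [add_comm 1, pow_zero]
    congr 2
    ring
  refine (GreenRing.mk_eq_of_isomorphic (directSum_cyc_isomorphic hq.out (NeZero.ne n)
    (a := b + 2) (b := b) hb hb1 (V := cycTensor q h2 hb2 0 0) (v := v) (w := w)
    ?_ ?_ ?_ ?_ ?_ ?_ ?_ ?_)).symm
  · exact gTensor_basisTmul ..
  · refine (hv _).trans ?_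
    rw [basisTmul_of_le_right (by omega), basisTmul_of_le_right (by omega), smul_zero, add_zero]
    rfl
  · intro h0
    have h0' := (hv _).symm.trans h0
    have := (congrArg (coordTmul 1 (Fin.last (b + 1))) h0').trans (map_zero _)
    rw [map_add, map_smul, coordTmul_basisTmul, coordTmul_basisTmul] at this
    exact geom_sum_inv_ne_zero hq.out (t := b + 2) (by omega) (by omega) (by simpa using this)
  · change gTensor q h2 hb2 0 0 w = q⁻¹ ^ 1 • w
    rw [map_add, map_smul, gTensor_basisTmul, gTensor_basisTmul, smul_add, smul_comm (1 - S)]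
  · refine (hw _).trans ?_
    rw [basisTmul_of_le_right (by omega), sub_self, zero_smul, zero_add]
    rfl
  · intro h0
    have h0' := (hw _).symm.trans h0
    have := (congrArg (coordTmul 0 (Fin.last (b + 1))) h0').trans (map_zero _)
    rw [map_add, map_smul, coordTmul_basisTmul, coordTmul_basisTmul] at this
    simp [add_comm 1 b] at this
  -- The socles have weights $b+2$ and $b+1$.
  · have := pow_inv_ne hq.out (NeZero.ne n) 0 (s := b + 2) (a := b + 1) (by omega) (by omega)
      (by omega)
    rwa [show 0 + (b + 1) = 1 + b by omega] at this
  · rw [finrank_cycTensor]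
    ring

/-- With right factor of length $n$, both $e_0\otimes e_0$ and $e_1\otimes e_0$ generate submodules
of the maximal length $n$, and their socle weights differ by one, so $q\ne1$ separates them. -/
theorem cycClass_two_mul_self (h2 : 2 ≤ n) :
    cycClass q h2 0 * cycClass q (le_refl n) 0 =
      cycClass q (le_refl n) 0 + cycClass q (le_refl n) 1 := by
  obtain ⟨b, rfl⟩ : ∃ b, n = b + 1 := ⟨n - 1, by omega⟩
  rw [cycClass, cycClass, cycClass, ← GreenRing.mk_tensor, ← GreenRing.mk_directSum]
  have hw : ∀ t, (hTensor q h2 le_rfl 0 0 ^ t) (basisTmul k 2 (b + 1) 1 0) =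
      basisTmul k 2 (b + 1) 1 t := by
    intro t
    rw [hTensor_pow_of_last _ _ _ _ _ _ rfl, zero_add]
  refine (GreenRing.mk_eq_of_isomorphic (directSum_cyc_isomorphic hq.out (NeZero.ne (b + 1))
    le_rfl le_rfl (V := cycTensor q h2 le_rfl 0 0) (v := basisTmul k 2 (b + 1) 0 0)
    (w := basisTmul k 2 (b + 1) 1 0) ?_ ?_ ?_ ?_ ?_ ?_ ?_ ?_)).symm
  · exact gTensor_basisTmul ..
  · rw [hAct_pow]
    rfl
  · intro h0
    have h0' := (hTensor_two_pow (q := q) h2 le_rfl 0 b).symm.trans h0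
    have := (congrArg (coordTmul 0 (Fin.last b)) h0').trans (map_zero _)
    rw [map_add, map_smul, coordTmul_basisTmul, coordTmul_basisTmul] at this
    simp at this
  · exact gTensor_basisTmul ..
  · rw [hAct_pow]
    rfl
  · intro h0
    have h0' := (hw b).symm.trans h0
    have := (congrArg (coordTmul 1 (Fin.last b)) h0').trans (map_zero _)
    rw [coordTmul_basisTmul] at this
    simp at this
  · have hq0 := hq.out.ne_zero (NeZero.ne (b + 1))
    rw [zero_add, pow_add, pow_one]
    intro h
    have h1 : q⁻¹ = 1 := by
      have := mul_right_cancel₀ (pow_ne_zero b (inv_ne_zero hq0)) ((one_mul _).trans h)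
      exact this.symm
    exact hq.out.inv.ne_one (by omega) h1
  · rw [finrank_cycTensor]
    ring

end Products

end TaftAlgebra

/-! ## The presentation of the Green ring -/

namespace TaftAlgebra

section Presentation

open MvPolynomial

/-- The polynomials with `f₀ = 0`, `f₁ = 1` and `f_{m+2} = z f_{m+1} - y f_m`. -/
def chebyshevLike {R : Type*} [Ring R] (y z : R) : ℕ → R
  | 0 => 0
  | 1 => 1
  | m + 2 => z * chebyshevLike y z (m + 1) - y * chebyshevLike y z m

theorem map_chebyshevLike {R S : Type*} [Ring R] [Ring S] (f : R →+* S) (y z : R) (m : ℕ) :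
    f (chebyshevLike y z m) = chebyshevLike (f y) (f z) m := by
  induction m using Nat.twoStepInduction with
  | zero => simp [chebyshevLike]
  | one => simp [chebyshevLike]
  | more m h1 h2 => rw [chebyshevLike, chebyshevLike, map_sub, map_mul, map_mul, h1, h2]

/-- The ideal of relations of the Green ring. -/
noncomputable def presentationIdeal (n : ℕ) : Ideal (MvPolynomial (Fin 2) ℤ) :=
  Ideal.span {X 0 ^ n - 1, (X 1 - X 0 - 1) * chebyshevLike (X 0) (X 1) n}

/-- The additive generators `y ^ r f_{a+1}` of the presented ring. -/
noncomputable def presentationBasis (n : ℕ) (x : Fin n × Fin n) :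
    MvPolynomial (Fin 2) ℤ ⧸ presentationIdeal n :=
  Ideal.Quotient.mk _ (X 0 ^ (x.2 : ℕ) * chebyshevLike (X 0) (X 1) (x.1 + 1))

theorem mk_y_pow (n : ℕ) : Ideal.Quotient.mk (presentationIdeal n) (X 0) ^ n = 1 := by
  rw [← map_pow, ← map_one (Ideal.Quotient.mk (presentationIdeal n)), Ideal.Quotient.eq]
  exact Ideal.subset_span (Or.inl rfl)

theorem mk_z_mul (n : ℕ) :
    Ideal.Quotient.mk (presentationIdeal n) (X 1) *
        Ideal.Quotient.mk (presentationIdeal n) (chebyshevLike (X 0) (X 1) n) =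
      (Ideal.Quotient.mk (presentationIdeal n) (X 0) + 1) *
        Ideal.Quotient.mk (presentationIdeal n) (chebyshevLike (X 0) (X 1) n) := by
  have h : Ideal.Quotient.mk (presentationIdeal n)
      ((X 1 - X 0 - 1) * chebyshevLike (X 0) (X 1) n) = 0 :=
    Ideal.Quotient.eq_zero_iff_mem.2 (Ideal.subset_span (Or.inr rfl))
  rw [map_mul, map_sub, map_sub, map_one] at h
  linear_combination h

theorem mk_mem_span_presentationBasis (n : ℕ) (r a : ℕ) (ha : a ≤ n) :
    Ideal.Quotient.mk (presentationIdeal n) (X 0 ^ r * chebyshevLike (X 0) (X 1) a) ∈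
      Submodule.span ℤ (Set.range (presentationBasis n)) := by
  cases a with
  | zero => simp [chebyshevLike]
  | succ a =>
    have hr : r % n < n := Nat.mod_lt _ (by omega)
    refine Submodule.subset_span ⟨(⟨a, ha⟩, ⟨r % n, hr⟩), ?_⟩
    rw [presentationBasis, map_mul, map_mul, map_pow, map_pow]
    conv_rhs => rw [← Nat.mod_add_div r n, pow_add, pow_mul, mk_y_pow, one_pow, mul_one]

/-- The span contains $f_1=1$ and is stable under $y$, because $y^n=1$, and under $z$:
$zf_{a+1}=f_{a+2}+yf_a$ below the top, and $zf_n=(y+1)f_n$ at the top. -/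
theorem span_presentationBasis {n : ℕ} (hn : 1 ≤ n) :
    Submodule.span ℤ (Set.range (presentationBasis n)) = ⊤ := by
  set S := Submodule.span ℤ (Set.range (presentationBasis n)) with hS
  have hmul : ∀ i x, x ∈ S → x * Ideal.Quotient.mk (presentationIdeal n) (X i) ∈ S := by
    intro i x hx
    induction hx using Submodule.span_induction with
    | zero => rw [zero_mul]; exact Submodule.zero_mem _
    | add x y _ _ hx hy => rw [add_mul]; exact Submodule.add_mem _ hx hy
    | smul c x _ hx => rw [smul_mul_assoc]; exact Submodule.smul_mem _ _ hx
    | mem x hx =>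
      obtain ⟨⟨a, r⟩, rfl⟩ := hx
      rw [presentationBasis]
      have hy := mk_mem_span_presentationBasis n (r + 1) (a + 1) a.2
      fin_cases i
      · convert hy using 1
        rw [← map_mul]
        congr 1
        simp only [Fin.zero_eta]
        ring
      · rcases Nat.lt_or_ge (a + 1) n with h | h
        · convert Submodule.add_mem _ (mk_mem_span_presentationBasis n r (a + 2) h)
            (mk_mem_span_presentationBasis n (r + 1) a (by omega)) using 1
          rw [← map_mul, ← map_add, chebyshevLike]
          congr 1
          simp only [Fin.mk_one]
          ring
        · have han : (a : ℕ) + 1 = n := by omega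
          have hz := mk_z_mul n
          rw [← han] at hz
          convert Submodule.add_mem _ hy
            (mk_mem_span_presentationBasis n r (a + 1) a.2) using 1
          simp only [Fin.mk_one, map_mul, map_pow] at hz ⊢
          rw [han] at hz ⊢
          linear_combination (Ideal.Quotient.mk (presentationIdeal n) (X 0)) ^ (r : ℕ) * hz
  rw [eq_top_iff]
  rintro x -
  obtain ⟨p, rfl⟩ := Ideal.Quotient.mk_surjective x
  induction p using MvPolynomial.induction_on with
  | C c =>
    have h1 := mk_mem_span_presentationBasis n 0 1 hn
    convert S.smul_mem c h1 using 1
    simp [chebyshevLike]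
  | add p p' hp hp' => rw [map_add]; exact Submodule.add_mem _ hp hp'
  | mul_X p i hp => rw [map_mul]; exact hmul i _ hp

end Presentation

/-! ### Comparison of the presented ring with the Green ring -/

section Isomorphism

open MvPolynomial

variable {k : Type u} [Field k] {n : ℕ} [NeZero n] {q : k} [hq : Fact (IsPrimitiveRoot q n)]

variable (q) in
/-- The images of `y` and `z` in the Green ring. -/
noncomputable def greenVar (h2 : 2 ≤ n) : Fin 2 → GreenRing k (TaftAlgebra k n q) :=
  ![cycClass q (by omega : 1 ≤ n) 1, cycClass q h2 0]

theorem commute_greenVar (h2 : 2 ≤ n) : greenVar q h2 0 * greenVar q h2 1 =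
    greenVar q h2 1 * greenVar q h2 0 :=
  (cycClass_one_mul (q := q) (by omega) h2 1 0).trans
    (cycClass_mul_one (q := q) (by omega) h2 0 1).symm

variable (q) in
/-- Evaluation of polynomials at the classes `y` and `z`, which commute. -/
noncomputable def greenEval (h2 : 2 ≤ n) :
    MvPolynomial (Fin 2) ℤ →+* GreenRing k (TaftAlgebra k n q) :=
  have hcomm : ∀ x ∈ Set.range (greenVar q h2), ∀ y ∈ Set.range (greenVar q h2),
      x * y = y * x := by
    rintro _ ⟨i, rfl⟩ _ ⟨j, rfl⟩
    fin_cases i <;> fin_cases j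
    · rfl
    · exact commute_greenVar h2
    · exact (commute_greenVar h2).symm
    · rfl
  -- The Green ring is not known to be commutative at this point, so evaluation takes place in the
  -- commutative subring generated by $y$ and $z$.
  letI : CommRing (Subring.closure (Set.range (greenVar q h2))) :=
    { (inferInstance : Ring (Subring.closure (Set.range (greenVar q h2)))) with
      mul_comm := (Subring.isMulCommutative_closure hcomm).is_comm.comm }
  (Subring.closure (Set.range (greenVar q h2))).subtype.comp
    (eval₂Hom (Int.castRingHom _) fun i =>
      (⟨greenVar q h2 i, Subring.subset_closure ⟨i, rfl⟩⟩ :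
        Subring.closure (Set.range (greenVar q h2))))

theorem greenEval_X (h2 : 2 ≤ n) (i : Fin 2) : greenEval q h2 (X i) = greenVar q h2 i := by
  simp [greenEval]

theorem cycClass_one_pow (h1 : 1 ≤ n) (r : ℕ) :
    cycClass q h1 1 ^ r = cycClass q h1 r := by
  induction r with
  | zero => rw [pow_zero, cycClass_one_of_pow_eq_one h1 (pow_zero _)]
  | succ r ih => rw [pow_succ, ih, cycClass_one_mul h1 h1]

/-- The recursion for $f_m$ is the rule `cycClass_two_mul` solved for its longest summand. -/
theorem chebyshevLike_greenVar (h2 : 2 ≤ n) : ∀ {a : ℕ} (ha : a + 1 ≤ n),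
    chebyshevLike (greenVar q h2 0) (greenVar q h2 1) (a + 1) = cycClass q ha 0
  | 0, ha => (cycClass_one_of_pow_eq_one ha (pow_zero _)).symm
  | 1, ha => by
    simp only [chebyshevLike, mul_one, mul_zero, sub_zero]
    rfl
  | b + 2, ha => by
    rw [chebyshevLike, chebyshevLike_greenVar h2 (by omega : b + 1 + 1 ≤ n),
      chebyshevLike_greenVar h2 (by omega : b + 1 ≤ n), sub_eq_iff_eq_add]
    refine (cycClass_two_mul h2 ha).trans ?_
    congr 1
    exact (cycClass_one_mul (q := q) (by omega) _ 1 0).symm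

theorem presentationIdeal_le_ker (h2 : 2 ≤ n) :
    presentationIdeal n ≤ RingHom.ker (greenEval q h2) := by
  have h1 : 1 ≤ n := by omega
  obtain ⟨b, hb⟩ : ∃ b, n = b + 1 := ⟨n - 1, by omega⟩
  have hbn : b + 1 ≤ n := hb.ge
  have hcyc : chebyshevLike (greenVar q h2 0) (greenVar q h2 1) n = cycClass q le_rfl 0 := by
    have := chebyshevLike_greenVar (q := q) h2 hbn
    convert this
  refine Ideal.span_le.2 ?_
  rintro _ (rfl | rfl)
  · rw [SetLike.mem_coe, RingHom.mem_ker, map_sub, map_pow, map_one, greenEval_X, sub_eq_zero]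
    exact (cycClass_one_pow h1 n).trans (cycClass_one_of_pow_eq_one h1 hq.out.inv.pow_eq_one)
  · rw [SetLike.mem_coe, RingHom.mem_ker, map_mul, map_sub, map_sub, map_one, map_chebyshevLike,
      greenEval_X, greenEval_X, hcyc, sub_mul, sub_mul, one_mul, sub_sub, sub_eq_zero]
    refine (cycClass_two_mul_self h2).trans ?_
    rw [add_comm]
    congr 1
    have : cycClass q h1 1 * cycClass q hbn 0 = cycClass q hbn 1 := cycClass_one_mul h1 hbn 1 0
    convert this.symm
    rfl

variable (q) in
/-- The homomorphism from the presented ring to the Green ring. -/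
noncomputable def greenHom (h2 : 2 ≤ n) :
    MvPolynomial (Fin 2) ℤ ⧸ presentationIdeal n →+* GreenRing k (TaftAlgebra k n q) :=
  Ideal.Quotient.lift _ (greenEval q h2) fun _ hx =>
    RingHom.mem_ker.1 (presentationIdeal_le_ker h2 hx)

theorem greenHom_presentationBasis (h2 : 2 ≤ n) (x : Fin n × Fin n) :
    greenHom q h2 (presentationBasis n x) = cycClass q (l := x.1 + 1) x.1.2 x.2 := by
  have h1 : 1 ≤ n := by omega
  rw [greenHom, presentationBasis, Ideal.Quotient.lift_mk, map_mul, map_pow, map_chebyshevLike,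
    greenEval_X, greenEval_X, chebyshevLike_greenVar h2 x.1.2]
  refine (congrArg (· * _) (cycClass_one_pow h1 x.2)).trans ?_
  exact cycClass_one_mul h1 x.1.2 x.2 0

/-- A spanning family is sent to a basis with the same index set. Coefficients of an element of the
kernel must vanish by independence, and surjectivity holds because the images span. -/
theorem greenHom_bijective (h2 : 2 ≤ n) : Function.Bijective (greenHom q h2) := by
  let f := (greenHom q h2).toAddMonoidHom.toIntLinearMap
  have hf : ∀ x, f (presentationBasis n x) = cycClass q (l := x.1 + 1) x.1.2 x.2 :=
    greenHom_presentationBasis h2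
  have hrange : Set.range (f ∘ presentationBasis n) =
      Set.range fun x : Fin n × Fin n => cycClass q (l := x.1 + 1) x.1.2 x.2 :=
    congrArg Set.range (funext hf)
  constructor
  · rw [injective_iff_map_eq_zero]
    intro x hx
    have hxs : x ∈ Submodule.span ℤ (Set.range (presentationBasis n)) := by
      rw [span_presentationBasis (by omega)]
      trivial
    obtain ⟨c, rfl⟩ := (Submodule.mem_span_range_iff_exists_fun ℤ).1 hxs
    have hx' : f (∑ i, c i • presentationBasis n i) = 0 := hx
    simp only [map_sum, map_smul, hf] at hx'
    have hc := Fintype.linearIndependent_iff.1 (linearIndependent_cycClass (q := q)) c hx'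
    exact Finset.sum_eq_zero fun i _ => by rw [hc i, zero_smul]
  · intro w
    have hw : w ∈ Submodule.span ℤ (Set.range (f ∘ presentationBasis n)) := by
      rw [hrange, span_cycClass]
      trivial
    rw [Set.range_comp, Submodule.span_image] at hw
    obtain ⟨x, -, hx⟩ := hw
    exact ⟨x, hx⟩

theorem nonempty_greenRing_ringEquiv (q : k) [Fact (IsPrimitiveRoot q n)] (h2 : 2 ≤ n) :
    Nonempty (GreenRing k (TaftAlgebra k n q) ≃+*
      MvPolynomial (Fin 2) ℤ ⧸ presentationIdeal n) :=
  ⟨(RingEquiv.ofBijective (greenHom q h2) (greenHom_bijective h2)).symm⟩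

/-- The presentation with the last relation written out. -/
theorem nonempty_greenRing_ringEquiv_of_eq (q : k) [Fact (IsPrimitiveRoot q n)] (h2 : 2 ≤ n)
    {p : MvPolynomial (Fin 2) ℤ} (hp : chebyshevLike (X 0) (X 1) n = p) :
    Nonempty (GreenRing k (TaftAlgebra k n q) ≃+*
      MvPolynomial (Fin 2) ℤ ⧸ Ideal.span {X 0 ^ n - 1, (X 1 - X 0 - 1) * p}) := by
  rw [← hp]
  exact nonempty_greenRing_ringEquiv q h2

end Isomorphism

end TaftAlgebra

theorem mainTheorem3 (k : Type u) [Field k] :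
    let y : MvPolynomial (Fin 2) ℤ := MvPolynomial.X 0
    let z : MvPolynomial (Fin 2) ℤ := MvPolynomial.X 1
    (∀ (q : k) [Fact (IsPrimitiveRoot q 2)],
      Nonempty (GreenRing k (TaftAlgebra k 2 q) ≃+*
        MvPolynomial (Fin 2) ℤ ⧸ Ideal.span {y ^ 2 - 1, (z - y - 1) * z})) ∧
    (∀ (q : k) [Fact (IsPrimitiveRoot q 3)],
      Nonempty (GreenRing k (TaftAlgebra k 3 q) ≃+*
        MvPolynomial (Fin 2) ℤ ⧸ Ideal.span {y ^ 3 - 1, (z - y - 1) * (z ^ 2 - y)})) ∧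
    (∀ (q : k) [Fact (IsPrimitiveRoot q 4)],
      Nonempty (GreenRing k (TaftAlgebra k 4 q) ≃+*
        MvPolynomial (Fin 2) ℤ ⧸ Ideal.span {y ^ 4 - 1, (z - y - 1) * (z ^ 3 - 2 * y * z)})) ∧
    (∀ (q : k) [Fact (IsPrimitiveRoot q 5)],
      Nonempty (GreenRing k (TaftAlgebra k 5 q) ≃+*
        MvPolynomial (Fin 2) ℤ ⧸
          Ideal.span {y ^ 5 - 1, (z - y - 1) * (z ^ 4 - 3 * y * z ^ 2 + y ^ 2)})) ∧
    (∀ (q : k) [Fact (IsPrimitiveRoot q 6)],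
      Nonempty (GreenRing k (TaftAlgebra k 6 q) ≃+*
        MvPolynomial (Fin 2) ℤ ⧸
          Ideal.span {y ^ 6 - 1, (z - y - 1) * (z ^ 5 - 4 * y * z ^ 3 + 3 * y ^ 2 * z)})) ∧
    (∀ (q : k) [Fact (IsPrimitiveRoot q 7)],
      Nonempty (GreenRing k (TaftAlgebra k 7 q) ≃+*
        MvPolynomial (Fin 2) ℤ ⧸
          Ideal.span {y ^ 7 - 1,
            (z - y - 1) * (z ^ 6 - 5 * y * z ^ 4 + 6 * y ^ 2 * z ^ 2 - y ^ 3)})) ∧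
    (∀ (q : k) [Fact (IsPrimitiveRoot q 8)],
      Nonempty (GreenRing k (TaftAlgebra k 8 q) ≃+*
        MvPolynomial (Fin 2) ℤ ⧸
          Ideal.span {y ^ 8 - 1,
            (z - y - 1) * (z ^ 7 - 6 * y * z ^ 5 + 10 * y ^ 2 * z ^ 3 - 4 * y ^ 3 * z)})) := by
  intro y z
  -- In each case it remains to unroll the recursion for $f_n$ and compare polynomials.
  refine ⟨?_, ?_, ?_, ?_, ?_, ?_, ?_⟩ <;> intro q _ <;>
    refine TaftAlgebra.nonempty_greenRing_ringEquiv_of_eq q (by norm_num) ?_ <;>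
    simp only [TaftAlgebra.chebyshevLike, y, z] <;> ring
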